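/- All graphs are finite and simple. For a graph $G$ let $\delta$ be its minimum degree and $\alpha=\alpha(G)$ its independence number. For an integer $b\ge 2$, a $[2,b]$-subgraph of $G$ is a subgraph $F$ of $G$ such that $2\le d_F(x)\le b$ for all $x\in V(F)$; $G-F$ denotes the subgraph of $G$ induced by $V(G)\setminus V(F)$. A pseudo $[2,b]$-factor of $G$ is a spanning subgraph of $G$ in which every connected component on at least three vertices has all its degrees between $2$ and $b$; the union of these components is called the $[2,b]$-subgraph of the pseudo $[2,b]$-factor (the remaining components are edges or single vertices). Call a $[2,b]$-subgraph $F$ of $G$ extremal if, among all $[2,b]$-subgraphs of $G$: (a) $\alpha(G-F)$ is as small as possible; (b) subject to (a), the number of vertices of a smallest component of $G-F$ (taken to be $0$ if $G-F$ has no vertices) is as small as possible; (c) subject to (a) and (b), $|V(F)|$ is as small as possible. **Theorem.** Let $b\ge 4$ be an integer and let $G$ be a graph with minimum degree $\delta\ge 2$ and independence number $\alpha>\frac{b(\delta-1)}{2}$. Then an extremal $[2,b]$-subgraph of $G$ exists, and for every extremal $[2,b]$-subgraph $F$ of $G$ there is a pseudo $[2,b]$-factor of $G$ whose $[2,b]$-subgraph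 is $F$, and $$\alpha(G-F)\le \alpha-\left\lfloor \tfrac{b}{2}(\delta-1)\right\rfloor .$$ -/

import Mathlib

namespace SimpleGraph

variable {V : Type*} {G : SimpleGraph V}

/-- An `[a, b]`-subgraph of `G`: every vertex of `F` has degree between `a` and `b` in `F`. -/
def Subgraph.IsDegSubgraph (F : G.Subgraph) (a b : ℕ) : Prop :=
  ∀ v ∈ F.verts, a ≤ (F.neighborSet v).ncard ∧ (F.neighborSet v).ncard ≤ b

/-- A pseudo `[a, b]`-factor of `G`: a spanning subgraph of `G` in which every connected component
with at least three vertices has all its degrees between `a` and `b`.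
(The degree of a vertex in its component is its degree in `H`.) -/
def Subgraph.IsPseudoFactor (H : G.Subgraph) (a b : ℕ) : Prop :=
  H.IsSpanning ∧ ∀ C : H.coe.ConnectedComponent, 3 ≤ C.supp.ncard →
    ∀ v ∈ C.supp, a ≤ (H.coe.neighborSet v).ncard ∧ (H.coe.neighborSet v).ncard ≤ b

/-- The union of the connected components of `H` that have at least three vertices, that is, that
are neither edges nor single vertices. -/
def Subgraph.largePart (H : G.Subgraph) : G.Subgraph :=
  H.induce {v | ∃ hv : v ∈ H.verts, 3 ≤ (H.coe.connectedComponentMk ⟨v, hv⟩).supp.ncard}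

/-- `G - F`: the subgraph of `G` induced by the vertices outside `F`. -/
abbrev Subgraph.outside (F : G.Subgraph) : SimpleGraph ↥(F.vertsᶜ) :=
  G.induce F.vertsᶜ

/-- The number of vertices of a smallest connected component
(it is `0` if the graph has no vertices). -/
noncomputable def minComponentCard {W : Type*} (K : SimpleGraph W) : ℕ :=
  ⨅ C : K.ConnectedComponent, C.supp.ncard

/-- The extremal choice of a `[2, b]`-subgraph `F` of `G`: `α(G - F)` is as small as possible;
subject to this, a smallest component of `G - F` has as few vertices as possible; subject to both,
`F` has as few vertices as possible. -/
structure Subgraph.IsExtremal (F : G.Subgraph) (b : ℕ) : Prop where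
  isDegSubgraph : F.IsDegSubgraph 2 b
  indepNum_le : ∀ F' : G.Subgraph, F'.IsDegSubgraph 2 b →
    F.outside.indepNum ≤ F'.outside.indepNum
  minComponentCard_le : ∀ F' : G.Subgraph, F'.IsDegSubgraph 2 b →
    F'.outside.indepNum = F.outside.indepNum →
    F.outside.minComponentCard ≤ F'.outside.minComponentCard
  ncard_verts_le : ∀ F' : G.Subgraph, F'.IsDegSubgraph 2 b →
    F'.outside.indepNum = F.outside.indepNum →
    F'.outside.minComponentCard = F.outside.minComponentCard →
    F.verts.ncard ≤ F'.verts.ncard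

end SimpleGraph

/-! Every `[2, b]`-subgraph becomes a pseudo factor once all other vertices are added as single
vertices, and an extremal one exists by finiteness. As an extremal subgraph minimizes the
independence number of the rest, the bound need only be shown for one `[2, b]`-subgraph. These are
treated as graphs on all of `V` whose isolated vertices are the uncovered ones. Take `F` optimal in
the sense of `IsOptimal`, and let `Z` be its set of uncovered vertices. If `Z` is empty, the
hypothesis on `α` gives the bound.

Otherwise let `P` be a longest path in `Z`, with ends `x₁`, `x₂`. An end has at most one neighbour
in `Z`, for else a cycle inside `Z` could be added to `F` (`IsOptimal.exists_path`). So each end has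
at least `δ - 1` covered neighbours. If `P` could be attached to `F` at both ends without exceeding
degree `b`, then all neighbours of `x₁` in `Z` would become covered and the independence number of
the rest would drop (`IsOptimal.not_absorb`). Hence one end has at least `δ - 1` covered neighbours
of degree `b`, except that one of them, the pivot, may have degree `b - 1`. Let `Y` be this set of
neighbours.

Minimal excess makes vertices of degree at least `3` pairwise nonadjacent in `F`. So every edge of
`F` at `Y` enters a thread, a path of vertices of degree `2`, and a thread has at most two such
ends. There are therefore at least `(b(δ - 1) - 1) / 2` threads at `Y`.

Each thread yields one more independent vertex. Erode it from `Y`, edge by edge. If adding the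
eroded vertices to `Z` never raised the independence number, the whole thread could be deleted,
lowering the excess. Stop just when the next vertex raises it. Two such removed parts are not
connected through `Z`, since otherwise the two loose ends could be joined by a path through `Z`,
again lowering the excess (`Erosion.not_linked`). The gains then add up (`indepOn_add_card_le`), so
`α` is at least `α(Z)` plus the number of threads. A pivot of degree `3` cannot afford to lose two
edges; there the contradiction comes from attaching `P` to it instead. -/

namespace SimpleGraph

/-! ### Independence numbers of vertex sets. -/

section IndepOn

variable {V : Type*} (G : SimpleGraph V)

/-- The independence number of the subgraph of `G` induced by `S`. -/
noncomputable def indepOn (S : Set V) : ℕ := (G.induce S).indepNum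

lemma isIndepSet_induce_iff {S : Set V} {s : Set S} :
    (G.induce S).IsIndepSet s ↔ G.IsIndepSet ((↑) '' s : Set V) := by
  rw [IsIndepSet, IsIndepSet, Set.InjOn.pairwise_image Subtype.val_injective.injOn]
  rfl

lemma exists_indepOn (S : Set V) :
    ∃ I : Set V, I ⊆ S ∧ G.IsIndepSet I ∧ I.ncard = G.indepOn S := by
  obtain ⟨s, hs, hc⟩ := (G.induce S).exists_isNIndepSet_indepNum
  refine ⟨(↑) '' (s : Set S), by simp, isIndepSet_induce_iff G |>.1 hs, ?_⟩
  rw [Set.ncard_image_of_injective _ Subtype.val_injective, Set.ncard_coe_finset, hc, indepOn]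

variable {G}

lemma indepOn_empty : G.indepOn ∅ = 0 := by
  obtain ⟨I, hI, -, hc⟩ := G.exists_indepOn ∅
  rw [← hc, Set.subset_empty_iff.1 hI, Set.ncard_empty]

variable [Finite V]

lemma IsIndepSet.ncard_le_indepOn {I S : Set V} (hI : G.IsIndepSet I) (hS : I ⊆ S) :
    I.ncard ≤ G.indepOn S := by
  classical
  have := Fintype.ofFinite V
  let t : Finset S := Finset.univ.filter fun x => (x : V) ∈ I
  have ht : (↑) '' (t : Set S) = I := by
    ext x
    simp only [t, Finset.coe_filter, Finset.mem_univ, true_and, Set.mem_image, Set.mem_ofPred_eq,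
      Subtype.exists, exists_and_left, exists_prop, exists_eq_right_right, and_iff_left_iff_imp]
    exact fun h => hS h
  have h : (G.induce S).IsIndepSet (t : Set S) := (isIndepSet_induce_iff G).2 (by rw [ht]; exact hI)
  have := h.card_le_indepNum
  rwa [← Set.ncard_coe_finset, ← Set.ncard_image_of_injective _ Subtype.val_injective, ht] at this

lemma indepOn_mono {S T : Set V} (h : S ⊆ T) : G.indepOn S ≤ G.indepOn T := by
  obtain ⟨I, hS, hI, hc⟩ := G.exists_indepOn S
  exact hc ▸ hI.ncard_le_indepOn (hS.trans h)

lemma indepOn_union_le (S T : Set V) : G.indepOn (S ∪ T) ≤ G.indepOn S + G.indepOn T := by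
  obtain ⟨I, hS, hI, hc⟩ := G.exists_indepOn (S ∪ T)
  have h1 : (I ∩ S).ncard ≤ G.indepOn S :=
    IsIndepSet.ncard_le_indepOn (hI.mono Set.inter_subset_left) Set.inter_subset_right
  have h2 : (I ∩ T).ncard ≤ G.indepOn T :=
    IsIndepSet.ncard_le_indepOn (hI.mono Set.inter_subset_left) Set.inter_subset_right
  have h3 : I = (I ∩ S) ∪ (I ∩ T) := by
    rw [← Set.inter_union_distrib_left]; exact (Set.inter_eq_left.2 hS).symm
  have := Set.ncard_union_le (I ∩ S) (I ∩ T)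
  rw [← h3] at this
  omega

lemma indepOn_add_le {S T : Set V} (hd : Disjoint S T) (h : ∀ s ∈ S, ∀ t ∈ T, ¬G.Adj s t) :
    G.indepOn S + G.indepOn T ≤ G.indepOn (S ∪ T) := by
  obtain ⟨I, hIS, hI, hIc⟩ := G.exists_indepOn S
  obtain ⟨J, hJT, hJ, hJc⟩ := G.exists_indepOn T
  have hIJ : G.IsIndepSet (I ∪ J) := by
    rintro x (hx | hx) y (hy | hy) hxy
    · exact hI hx hy hxy
    · exact h _ (hIS hx) _ (hJT hy)
    · exact fun e => h _ (hIS hy) _ (hJT hx) e.symm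
    · exact hJ hx hy hxy
  have := hIJ.ncard_le_indepOn (Set.union_subset_union hIS hJT)
  rwa [Set.ncard_union_eq (hd.mono hIS hJT), hIc, hJc] at this

/-- The vertex `x` can be added to any independent subset of `S`. This is how covering all uncovered
neighbours of a vertex together with the vertex itself lowers the independence number of the rest.
-/
lemma indepOn_lt {S T : Set V} (hST : S ⊆ T) {x : V} (hx : x ∈ T) (hxS : x ∉ S)
    (h : ∀ s ∈ S, ¬G.Adj x s) : G.indepOn S < G.indepOn T := by
  obtain ⟨I, hI, hI', hc⟩ := G.exists_indepOn S
  have : G.IsIndepSet (insert x I) := by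
    rintro u (rfl | hu) v (rfl | hv) huv
    · exact (huv rfl).elim
    · exact h _ (hI hv)
    · exact fun e => h _ (hI hu) e.symm
    · exact hI' hu hv huv
  have := this.ncard_le_indepOn (S := T) (Set.insert_subset hx (hI.trans hST))
  rw [Set.ncard_insert_of_notMem fun h => hxS (hI h)] at this
  omega

lemma indepOn_univ : G.indepOn Set.univ = G.indepNum := by
  obtain ⟨I, -, hI', hc⟩ := G.exists_indepOn Set.univ
  have := Fintype.ofFinite V
  classical
  refine le_antisymm ?_ ?_
  · rw [← hc]
    have : G.IsIndepSet (I.toFinset : Set V) := by simpa using hI'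
    have := this.card_le_indepNum
    rwa [← Set.ncard_eq_toFinset_card'] at this
  · obtain ⟨s, hs, hc⟩ := G.exists_isNIndepSet_indepNum
    rw [← hc, ← Set.ncard_coe_finset]
    exact hs.ncard_le_indepOn (Set.subset_univ _)

lemma indepOn_biUnion_le {ι : Type*} (s : Finset ι) (S : Set V) (X : ι → Set V) :
    G.indepOn (S ∪ ⋃ i ∈ s, X i) ≤ G.indepOn S + ∑ i ∈ s, G.indepOn (X i) := by
  classical
  induction s using Finset.induction_on with
  | empty => simp
  | insert a s ha ih =>
    rw [Finset.sum_insert ha, Finset.set_biUnion_insert, Set.union_left_comm]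
    have := indepOn_union_le (G := G) (X a) (S ∪ ⋃ i ∈ s, X i)
    omega

lemma le_indepOn_biUnion {ι : Type*} (s : Finset ι) (S : Set V) (X : ι → Set V)
    (hS : ∀ i ∈ s, Disjoint (X i) S) (hS' : ∀ i ∈ s, ∀ x ∈ X i, ∀ y ∈ S, ¬G.Adj x y)
    (hX : ∀ i ∈ s, ∀ j ∈ s, i ≠ j → Disjoint (X i) (X j))
    (hX' : ∀ i ∈ s, ∀ j ∈ s, i ≠ j → ∀ x ∈ X i, ∀ y ∈ X j, ¬G.Adj x y) :
    G.indepOn S + ∑ i ∈ s, G.indepOn (X i) ≤ G.indepOn (S ∪ ⋃ i ∈ s, X i) := by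
  classical
  induction s using Finset.induction_on with
  | empty => simp
  | insert a s ha ih =>
    rw [Finset.sum_insert ha, Finset.set_biUnion_insert, Set.union_left_comm]
    have hne : ∀ i ∈ s, a ≠ i := fun i hi h => ha (h ▸ hi)
    have h1 := ih (fun i hi => hS i (Finset.mem_insert_of_mem hi))
      (fun i hi => hS' i (Finset.mem_insert_of_mem hi))
      (fun i hi j hj => hX i (Finset.mem_insert_of_mem hi) j (Finset.mem_insert_of_mem hj))
      (fun i hi j hj => hX' i (Finset.mem_insert_of_mem hi) j (Finset.mem_insert_of_mem hj))
    have h2 := indepOn_add_le (G := G) (S := X a) (T := S ∪ ⋃ i ∈ s, X i) (by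
      rw [Set.disjoint_union_right, Set.disjoint_iUnion₂_right]
      exact ⟨hS a (Finset.mem_insert_self _ _), fun i hi => hX a (Finset.mem_insert_self _ _) i
        (Finset.mem_insert_of_mem hi) (hne i hi)⟩) (by
      rintro x hx y (hy | hy)
      · exact hS' a (Finset.mem_insert_self _ _) x hx y hy
      · simp only [Set.mem_iUnion] at hy
        obtain ⟨i, hi, hy⟩ := hy
        exact hX' a (Finset.mem_insert_self _ _) i (Finset.mem_insert_of_mem hi) (hne i hi) x hx
          y hy)
    omega

end IndepOn

/-! ### Degrees under adding and deleting edges and paths. -/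

section Valence

variable {V : Type*} {F H : SimpleGraph V}

/-- The degree of `v` in `F`, independent of any decidability instance. -/
noncomputable def valence (F : SimpleGraph V) (v : V) : ℕ := (F.neighborSet v).ncard

/-- The set of isolated vertices of `F`. -/
def isolatedSet (F : SimpleGraph V) : Set V := {v | F.valence v = 0}

lemma mem_isolatedSet {v : V} : v ∈ F.isolatedSet ↔ F.valence v = 0 := Iff.rfl

lemma valence_sup_edge_of_ne {u v w : V} (hu : w ≠ u) (hv : w ≠ v) :
    (F ⊔ edge u v).valence w = F.valence w := by
  have : (F ⊔ edge u v).neighborSet w = F.neighborSet w := by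
    ext x; simp [edge_adj]; grind
  rw [valence, this, valence]

lemma valence_sdiff_edge_of_ne {u v w : V} (hu : w ≠ u) (hv : w ≠ v) :
    (F \ edge u v).valence w = F.valence w := by
  have : (F \ edge u v).neighborSet w = F.neighborSet w := by
    ext x; simp [edge_adj]; grind
  rw [valence, this, valence]

lemma sup_edge_adj' {u v x y : V} (h : u ≠ v) :
    (F ⊔ edge u v).Adj x y ↔ F.Adj x y ∨ (x = u ∧ y = v ∨ x = v ∧ y = u) := by
  simp only [sup_adj, edge_adj]; grind

variable [Finite V]

lemma valence_eq_zero {v : V} : F.valence v = 0 ↔ ∀ w, ¬F.Adj v w := by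
  rw [valence, Set.ncard_eq_zero, Set.eq_empty_iff_forall_notMem]; rfl

lemma Adj.valence_pos {v w : V} (h : F.Adj v w) : 0 < F.valence v :=
  Nat.pos_of_ne_zero fun h0 => valence_eq_zero.1 h0 w h

lemma valence_mono (h : H ≤ F) (v : V) : H.valence v ≤ F.valence v :=
  Set.ncard_le_ncard fun _ hw => h hw

lemma isolatedSet_anti (h : H ≤ F) : F.isolatedSet ⊆ H.isolatedSet := fun v hv =>
  Nat.le_zero.1 ((valence_mono h v).trans hv.le)

lemma valence_add_valence_inf {H' : SimpleGraph V} (hF : H ⊔ H' = F) (v : V) :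
    F.valence v + (H ⊓ H').valence v = H.valence v + H'.valence v := by
  subst hF
  have h1 : (H ⊔ H').neighborSet v = H.neighborSet v ∪ H'.neighborSet v := by ext; simp
  have h2 : (H ⊓ H').neighborSet v = H.neighborSet v ∩ H'.neighborSet v := by ext; simp
  rw [valence, valence, h1, h2, Set.ncard_union_add_ncard_inter, valence, valence]

lemma valence_sup_edge_left {u v : V} (h : ¬F.Adj u v) (huv : u ≠ v) :
    (F ⊔ edge u v).valence u = F.valence u + 1 := by
  have : (F ⊔ edge u v).neighborSet u = insert v (F.neighborSet u) := by
    ext w; simp [edge_adj]; grind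
  rw [valence, this, Set.ncard_insert_of_notMem (by simpa using h), valence]

lemma valence_sup_edge_right {u v : V} (h : ¬F.Adj u v) (huv : u ≠ v) :
    (F ⊔ edge u v).valence v = F.valence v + 1 := by
  rw [edge_comm]; exact valence_sup_edge_left (fun e => h e.symm) huv.symm

lemma valence_sdiff_edge_left {u v : V} (h : F.Adj u v) :
    (F \ edge u v).valence u + 1 = F.valence u := by
  have h' : ¬(F \ edge u v).Adj u v := by simp [edge_adj, h.ne]
  have := valence_sup_edge_left h' h.ne
  rwa [sdiff_sup_cancel (by rw [edge_le_iff]; exact Or.inr h), eq_comm] at this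

lemma valence_sdiff_edge_right {u v : V} (h : F.Adj u v) :
    (F \ edge u v).valence v + 1 = F.valence v := by
  rw [edge_comm]; exact valence_sdiff_edge_left h.symm

/-- Joining two vertices `e`, `e'` by a path whose interior consists of isolated vertices of `H`. -/
lemma exists_add_path {G : SimpleGraph V} {e e' : V} (p : G.Walk e e') (hp : p.IsPath)
    (hne : e ≠ e') (hH : H ≤ G) (hadj : p.length = 1 → ¬H.Adj e e')
    (hint : ∀ x ∈ p.support, x ≠ e → x ≠ e' → x ∈ H.isolatedSet) :
    ∃ F : SimpleGraph V, F ≤ G ∧ H ≤ F ∧ F.valence e = H.valence e + 1 ∧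
      F.valence e' = H.valence e' + 1 ∧
      (∀ x ∈ p.support, x ≠ e → x ≠ e' → F.valence x = 2) ∧
      (∀ x ∉ p.support, F.valence x = H.valence x) := by
  induction p generalizing H with
  | nil => exact (hne rfl).elim
  | @cons e w e' h q ih =>
    rw [Walk.cons_isPath_iff] at hp
    have hHw : H ⊔ edge e w ≤ G := sup_le hH (by rw [edge_le_iff]; exact Or.inr h)
    by_cases hw : w = e'
    · subst hw
      have hq : q = Walk.nil := (Walk.isPath_iff_nil.1 hp.1).eq_nil
      subst hq
      refine ⟨H ⊔ edge e w, hHw, le_sup_left, valence_sup_edge_left (hadj rfl) hne,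
        valence_sup_edge_right (hadj rfl) hne, ?_, ?_⟩
      · simp +contextual
      · simp only [Walk.support_cons, Walk.support_nil, List.mem_cons, List.not_mem_nil, or_false,
          not_or]
        exact fun x hx => valence_sup_edge_of_ne hx.1 hx.2
    · have hwe : w ≠ e := h.ne'
      have hw0 : H.valence w = 0 :=
        hint w (List.mem_cons_of_mem _ q.start_mem_support) hwe hw
      have hew : ¬H.Adj e w := fun a => valence_eq_zero.1 hw0 _ a.symm
      -- Once the edge `e w` is added, `w` has degree `1` and takes over the role of `e`; the rest
      -- of the path raises it to `2`.
      obtain ⟨F, hFG, hHF, h1, h2, h3, h4⟩ := ih (H := H ⊔ edge e w) hp.1 hw hHw (by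
          rw [sup_edge_adj' h.ne]
          rintro - (a | a | a)
          · exact valence_eq_zero.1 hw0 _ a
          · exact hwe a.1
          · exact hne a.2.symm) (by
          intro x hx hxw hxe'
          have hxe : x ≠ e := fun a => hp.2 (a ▸ hx)
          rw [mem_isolatedSet, valence_sup_edge_of_ne hxe hxw]
          exact hint x (List.mem_cons_of_mem _ hx) hxe hxe')
      rw [valence_sup_edge_right hew h.ne, hw0] at h1
      refine ⟨F, hFG, le_sup_left.trans hHF, ?_, ?_, ?_, ?_⟩
      · rw [h4 e hp.2, valence_sup_edge_left hew h.ne]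
      · rw [h2, valence_sup_edge_of_ne hne.symm (Ne.symm hw)]
      · intro x hx hxe hxe'
        rw [Walk.support_cons, List.mem_cons] at hx
        by_cases hxw : x = w
        · rw [hxw, h1]
        · exact h3 x (hx.resolve_left hxe) hxw hxe'
      · intro x hx
        rw [Walk.support_cons, List.mem_cons, not_or] at hx
        rw [h4 x hx.2, valence_sup_edge_of_ne hx.1]
        rintro rfl
        exact hx.2 q.start_mem_support

end Valence

/-! ### Connection through a vertex set, and additivity of the independence number. -/

section Linked

variable {V : Type*} {G : SimpleGraph V} {S T A A' : Set V} {u v w : V}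

/-- `u` and `v` are joined in `G` by a walk whose other vertices belong to `S`. -/
def Linked (G : SimpleGraph V) (S : Set V) (u v : V) : Prop :=
  ∃ p : G.Walk u v, ∀ x ∈ p.support, x = u ∨ x = v ∨ x ∈ S

lemma Linked.refl (u : V) : G.Linked S u u := ⟨Walk.nil, by simp⟩

lemma Linked.symm (h : G.Linked S u v) : G.Linked S v u := by
  obtain ⟨p, hp⟩ := h
  refine ⟨p.reverse, fun x hx => ?_⟩
  have := hp x (by simpa using hx)
  tauto

lemma Linked.mono (hST : S ⊆ T) (h : G.Linked S u v) : G.Linked T u v := by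
  obtain ⟨p, hp⟩ := h
  exact ⟨p, fun x hx => (hp x hx).imp_right (Or.imp_right (@hST x))⟩

lemma Adj.linked (h : G.Adj u v) : G.Linked S u v := ⟨h.toWalk, by simp⟩

lemma Linked.trans (h : G.Linked S u v) (h' : G.Linked S v w) (hv : v = u ∨ v = w ∨ v ∈ S) :
    G.Linked S u w := by
  obtain ⟨p, hp⟩ := h
  obtain ⟨q, hq⟩ := h'
  refine ⟨p.append q, fun x hx => ?_⟩
  rw [Walk.mem_support_append_iff] at hx
  rcases hx with hx | hx
  · rcases hp x hx with h | rfl | h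
    · exact Or.inl h
    · exact hv
    · exact Or.inr (Or.inr h)
  · rcases hq x hx with rfl | h | h
    · exact hv
    · exact Or.inr (Or.inl h)
    · exact Or.inr (Or.inr h)

lemma Linked.exists_isPath (h : G.Linked S u v) :
    ∃ p : G.Walk u v, p.IsPath ∧ ∀ x ∈ p.support, x = u ∨ x = v ∨ x ∈ S := by
  classical
  obtain ⟨p, hp⟩ := h
  exact ⟨p.bypass, p.bypass_isPath, fun x hx => hp x (p.support_bypass_subset_support hx)⟩

/-- The vertices of `A` together with all vertices of `S` that can be reached from `A`
through `S`. -/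
def block (G : SimpleGraph V) (S A : Set V) : Set V :=
  A ∪ {w | w ∈ S ∧ ∃ a ∈ A, G.Linked S a w}

lemma exists_linked_of_mem_block (h : w ∈ G.block S A) :
    ∃ a ∈ A, G.Linked S a w ∧ (w = a ∨ w ∈ S) := by
  rcases h with h | ⟨h, a, ha, hl⟩
  · exact ⟨w, h, Linked.refl _, Or.inl rfl⟩
  · exact ⟨a, ha, hl, Or.inr h⟩

lemma not_adj_of_mem_block (hu : u ∈ G.block S A) (hv : v ∈ S \ G.block S A) : ¬G.Adj u v := by
  intro h
  obtain ⟨a, ha, hl, hua⟩ := exists_linked_of_mem_block hu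
  exact hv.2 (Or.inr ⟨hv.1, a, ha, hl.trans h.linked (by tauto)⟩)

lemma not_linked_of_mem_block (h : ∀ a ∈ A, ∀ a' ∈ A', ¬G.Linked S a a')
    (hu : u ∈ G.block S A) (hv : v ∈ G.block S A') : ¬G.Linked S u v := by
  intro hl
  obtain ⟨a, ha, hau, hu'⟩ := exists_linked_of_mem_block hu
  obtain ⟨a', ha', hav, hv'⟩ := exists_linked_of_mem_block hv
  exact h a ha a' ha' ((hau.trans hl (by tauto)).trans hav.symm (by tauto))

lemma disjoint_block (h : ∀ a ∈ A, ∀ a' ∈ A', ¬G.Linked S a a') :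
    Disjoint (G.block S A) (G.block S A') :=
  Set.disjoint_left.2 fun _ hu hu' => not_linked_of_mem_block h hu hu' (Linked.refl _)

lemma not_adj_of_blocks (h : ∀ a ∈ A, ∀ a' ∈ A', ¬G.Linked S a a')
    (hu : u ∈ G.block S A) (hv : v ∈ G.block S A') : ¬G.Adj u v :=
  fun e => not_linked_of_mem_block h hu hv e.linked

lemma subset_block : A ⊆ G.block S A := Set.subset_union_left

lemma block_subset : G.block S A ⊆ S ∪ A := by
  rintro x (h | h)
  · exact Or.inr h
  · exact Or.inl h.1

variable [Finite V]

lemma indepOn_sdiff_block_add :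
    G.indepOn (S \ G.block S A) + G.indepOn (G.block S A) = G.indepOn (S ∪ A) := by
  have : S ∪ A = (S \ G.block S A) ∪ G.block S A := by
    rw [Set.sdiff_union_self]
    exact Set.Subset.antisymm (Set.union_subset_union_right _ subset_block)
      (Set.union_subset Set.subset_union_left block_subset)
  rw [this]
  exact le_antisymm
    (indepOn_add_le Set.disjoint_sdiff_left fun s hs t ht e => not_adj_of_mem_block ht hs e.symm)
    (indepOn_union_le _ _)

lemma indepOn_sdiff_block_add_inter :
    G.indepOn (S \ G.block S A) + G.indepOn (S ∩ G.block S A) = G.indepOn S := by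
  conv_rhs => rw [← Set.sdiff_union_inter S (G.block S A)]
  exact le_antisymm
    (indepOn_add_le (Set.disjoint_sdiff_left.mono_right Set.inter_subset_right)
      fun s hs t ht e => not_adj_of_mem_block ht.2 hs e.symm)
    (indepOn_union_le _ _)

/-- Blocks of pairwise unlinked sets are disjoint, with no edges between them or to the rest of `S`,
so independence numbers add. -/
lemma indepOn_blocks {ι : Type*} (s : Finset ι) (A : ι → Set V)
    (h : ∀ i ∈ s, ∀ j ∈ s, i ≠ j → ∀ a ∈ A i, ∀ a' ∈ A j, ¬G.Linked S a a') :
    G.indepOn (S \ ⋃ i ∈ s, G.block S (A i)) + ∑ i ∈ s, G.indepOn (G.block S (A i)) =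
      G.indepOn (S ∪ ⋃ i ∈ s, A i) := by
  set D := ⋃ i ∈ s, G.block S (A i) with hD
  have hsub : ∀ i ∈ s, G.block S (A i) ⊆ D := fun i hi =>
    Set.subset_iUnion₂ (s := fun i _ => G.block S (A i)) i hi
  have : S ∪ ⋃ i ∈ s, A i = (S \ D) ∪ D := by
    rw [Set.sdiff_union_self]
    refine Set.Subset.antisymm (Set.union_subset_union_right _ ?_)
      (Set.union_subset Set.subset_union_left ?_)
    · exact Set.iUnion₂_mono fun i _ => subset_block
    · exact Set.iUnion₂_subset fun i hi => block_subset.trans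
        (Set.union_subset_union_right _ (Set.subset_iUnion₂ (s := fun i _ => A i) i hi))
  rw [this]
  refine le_antisymm (le_indepOn_biUnion _ _ _ ?_ ?_ ?_ ?_) (indepOn_biUnion_le _ _ _)
  · exact fun i hi => Set.disjoint_sdiff_right.mono_left (hsub i hi)
  · exact fun i hi x hx y hy => not_adj_of_mem_block hx ⟨hy.1, fun hy' => hy.2 (hsub i hi hy')⟩
  · exact fun i hi j hj hij => disjoint_block (h i hi j hj hij)
  · exact fun i hi j hj hij x hx y hy => not_adj_of_blocks (h i hi j hj hij) hx hy

lemma indepOn_blocks_inter {ι : Type*} (s : Finset ι) (A : ι → Set V)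
    (h : ∀ i ∈ s, ∀ j ∈ s, i ≠ j → ∀ a ∈ A i, ∀ a' ∈ A j, ¬G.Linked S a a') :
    G.indepOn (S \ ⋃ i ∈ s, G.block S (A i)) + ∑ i ∈ s, G.indepOn (S ∩ G.block S (A i)) =
      G.indepOn S := by
  set D := ⋃ i ∈ s, G.block S (A i) with hD
  have hsub : ∀ i ∈ s, G.block S (A i) ⊆ D := fun i hi =>
    Set.subset_iUnion₂ (s := fun i _ => G.block S (A i)) i hi
  have : S = (S \ D) ∪ ⋃ i ∈ s, S ∩ G.block S (A i) := by
    rw [← Set.inter_iUnion₂, Set.sdiff_union_inter]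
  conv_rhs => rw [this]
  refine le_antisymm (le_indepOn_biUnion _ _ _ ?_ ?_ ?_ ?_) (indepOn_biUnion_le _ _ _)
  · exact fun i hi => Set.disjoint_sdiff_right.mono_left (Set.inter_subset_right.trans (hsub i hi))
  · exact fun i hi x hx y hy => not_adj_of_mem_block hx.2 ⟨hy.1, fun hy' => hy.2 (hsub i hi hy')⟩
  · exact fun i hi j hj hij => (disjoint_block (h i hi j hj hij)).mono Set.inter_subset_right
      Set.inter_subset_right
  · exact fun i hi j hj hij x hx y hy => not_adj_of_blocks (h i hi j hj hij) hx.2 hy.2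

/-- Both sides split over the same blocks. A gain of `A i` over `S` must occur inside its own block,
so the gains are independent of each other. -/
lemma indepOn_add_card_le {ι : Type*} (s : Finset ι) (A : ι → Set V)
    (h : ∀ i ∈ s, ∀ j ∈ s, i ≠ j → ∀ a ∈ A i, ∀ a' ∈ A j, ¬G.Linked S a a')
    (hA : ∀ i ∈ s, G.indepOn S < G.indepOn (S ∪ A i)) :
    G.indepOn S + s.card ≤ G.indepOn (S ∪ ⋃ i ∈ s, A i) := by
  rw [← indepOn_blocks s A h, ← indepOn_blocks_inter s A h, add_assoc, Finset.card_eq_sum_ones,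
    ← Finset.sum_add_distrib]
  refine Nat.add_le_add_left (Finset.sum_le_sum fun i hi => ?_) _
  have := hA i hi
  have h1 := indepOn_sdiff_block_add (G := G) (S := S) (A := A i)
  have h2 := indepOn_sdiff_block_add_inter (G := G) (S := S) (A := A i)
  omega

lemma indepOn_union_union_le (h : ∀ a ∈ A, ∀ a' ∈ A', ¬G.Linked S a a')
    (hA : G.indepOn (S ∪ A) ≤ G.indepOn S) (hA' : G.indepOn (S ∪ A') ≤ G.indepOn S) :
    G.indepOn (S ∪ (A ∪ A')) ≤ G.indepOn S := by
  let B : Bool → Set V := fun i => cond i A A'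
  have hB : ∀ i ∈ (Finset.univ : Finset Bool), ∀ j ∈ (Finset.univ : Finset Bool), i ≠ j →
      ∀ a ∈ B i, ∀ a' ∈ B j, ¬G.Linked S a a' := by
    rintro (_ | _) - (_ | _) - hij a ha a' ha'
    · exact (hij rfl).elim
    · exact fun hl => h a' ha' a ha hl.symm
    · exact h a ha a' ha'
    · exact (hij rfl).elim
  have hU : S ∪ (A ∪ A') = S ∪ ⋃ i ∈ (Finset.univ : Finset Bool), B i := by
    rw [Set.union_eq_iUnion (s₁ := A)]; simp [B]
  rw [hU, ← indepOn_blocks _ B hB, ← indepOn_blocks_inter _ B hB]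
  refine Nat.add_le_add_left (Finset.sum_le_sum fun i _ => ?_) _
  have : G.indepOn (S ∪ B i) ≤ G.indepOn S := by cases i <;> assumption
  have h1 := indepOn_sdiff_block_add (G := G) (S := S) (A := B i)
  have h2 := indepOn_sdiff_block_add_inter (G := G) (S := S) (A := B i)
  omega

end Linked

/-! ### Optimal graphs, threads and their erosion. -/

section Erosion

variable {V : Type*} {G F H : SimpleGraph V} {b : ℕ}

/-- Every vertex is isolated or has degree between `2` and `b`: the graphs of this kind contained
in `G` correspond to the `[2, b]`-subgraphs of `G`. -/
def IsDegGraph (F : SimpleGraph V) (b : ℕ) : Prop :=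
  ∀ v, F.valence v = 0 ∨ 2 ≤ F.valence v ∧ F.valence v ≤ b

/-- The sum of `d(v) - 2` over all vertices `v` of degree at least `2`. -/
noncomputable def excess [Fintype V] (F : SimpleGraph V) : ℕ := ∑ v, (F.valence v - 2)

lemma excess_le [Fintype V] (h : ∀ v, H.valence v ≤ F.valence v ∨ H.valence v ≤ 2) :
    H.excess ≤ F.excess :=
  Finset.sum_le_sum fun v _ => by have := h v; omega

lemma excess_lt [Fintype V] (h : ∀ v, H.valence v ≤ F.valence v ∨ H.valence v ≤ 2) {v : V}
    (hv : H.valence v < F.valence v) (hv' : 3 ≤ F.valence v) : H.excess < F.excess :=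
  Finset.sum_lt_sum (fun v _ => by have := h v; omega) ⟨v, Finset.mem_univ _, by omega⟩

/-- Among the `[2, b]`-subgraphs of `G`, `F` minimizes first the independence number of the rest,
then the excess, then the number of uncovered vertices. -/
structure IsOptimal [Fintype V] (G F : SimpleGraph V) (b : ℕ) : Prop where
  le : F ≤ G
  isDegGraph : F.IsDegGraph b
  indepOn_le : ∀ F' ≤ G, F'.IsDegGraph b → G.indepOn F.isolatedSet ≤ G.indepOn F'.isolatedSet
  excess_le : ∀ F' ≤ G, F'.IsDegGraph b → G.indepOn F'.isolatedSet ≤ G.indepOn F.isolatedSet →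
    F.excess ≤ F'.excess
  ncard_le : ∀ F' ≤ G, F'.IsDegGraph b → G.indepOn F'.isolatedSet ≤ G.indepOn F.isolatedSet →
    F'.excess ≤ F.excess → F.isolatedSet.ncard ≤ F'.isolatedSet.ncard

lemma exists_isOptimal [Fintype V] (G : SimpleGraph V) (b : ℕ) : ∃ F, G.IsOptimal F b := by
  let key : SimpleGraph V → ℕ ×ₗ ℕ ×ₗ ℕ := fun F =>
    toLex (G.indepOn F.isolatedSet, toLex (F.excess, F.isolatedSet.ncard))
  have hbot : (⊥ : SimpleGraph V) ∈ {F | F ≤ G ∧ F.IsDegGraph b} :=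
    ⟨bot_le, fun v => Or.inl (valence_eq_zero.2 (by simp))⟩
  obtain ⟨F, ⟨hF, hd⟩, hmin⟩ := (InvImage.wf key wellFounded_lt).has_min _ ⟨⊥, hbot⟩
  have hkey : ∀ F' ≤ G, F'.IsDegGraph b → ¬key F' < key F := fun F' h1 h2 => hmin F' ⟨h1, h2⟩
  simp only [key, Prod.Lex.toLex_lt_toLex] at hkey
  refine ⟨F, hF, hd, fun F' h1 h2 => ?_, fun F' h1 h2 h3 => ?_, fun F' h1 h2 h3 h4 => ?_⟩ <;>
  · have := hkey F' h1 h2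
    omega

/-- The graph formed by the edges of `F` both of whose ends have degree `2`. -/
def threadGraph (F : SimpleGraph V) : SimpleGraph V where
  Adj u v := F.Adj u v ∧ F.valence u = 2 ∧ F.valence v = 2
  symm := ⟨fun _ _ h => ⟨h.1.symm, h.2.2, h.2.1⟩⟩
  loopless := ⟨fun _ h => h.1.ne rfl⟩

lemma connectedComponentMk_eq_of_adj {u v : V} (h : F.Adj u v) (hu : F.valence u = 2)
    (hv : F.valence v = 2) :
    F.threadGraph.connectedComponentMk u = F.threadGraph.connectedComponentMk v :=
  ConnectedComponent.sound (Adj.reachable (G := F.threadGraph) ⟨h, hu, hv⟩)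

/-- `Erosion F y k H e`: `H` is obtained from `F` by deleting an initial segment, starting at `y`,
of the thread `k`; the end `e` of the remaining part has degree `1` in `H`. -/
inductive Erosion (F : SimpleGraph V) (y : V) (k : F.threadGraph.ConnectedComponent) :
    SimpleGraph V → V → Prop
  | start {z : V} (h : F.Adj y z) (hz : F.valence z = 2)
      (hk : F.threadGraph.connectedComponentMk z = k) : Erosion F y k (F \ edge y z) z
  | step {H : SimpleGraph V} {e e' : V} (hH : Erosion F y k H e) (h : H.Adj e e')
      (he' : F.valence e' = 2) : Erosion F y k (H \ edge e e') e'

/-- The degrees and the deleted edges after erosion of a thread. -/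
structure ErosionProfile (F : SimpleGraph V) (y : V) (k : F.threadGraph.ConnectedComponent)
    (H : SimpleGraph V) (e : V) : Prop where
  le : H ≤ F
  deleted : ∀ u v, F.Adj u v → ¬H.Adj u v →
    (F.valence u = 2 ∧ F.threadGraph.connectedComponentMk u = k) ∨
      (F.valence v = 2 ∧ F.threadGraph.connectedComponentMk v = k)
  valence_end : F.valence e = 2
  valence_end' : H.valence e = 1
  mk_end : F.threadGraph.connectedComponentMk e = k
  valence_two : ∀ v, v ≠ e → F.valence v = 2 → H.valence v = 2 ∨
    (H.valence v = 0 ∧ F.threadGraph.connectedComponentMk v = k)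
  valence_ne_two : ∀ v, v ≠ y → F.valence v ≠ 2 → H.valence v = F.valence v
  valence_source : H.valence y + 1 = F.valence y

variable {y y' e e' : V} {k k' : F.threadGraph.ConnectedComponent} {H' : SimpleGraph V}

lemma ErosionProfile.end_notMem (hP : ErosionProfile F y k H e) : e ∉ H.isolatedSet := by
  rw [mem_isolatedSet, hP.valence_end']; omega

/-- Every deleted edge has an end on the eroded thread, and no edge meets two threads; so no edge is
deleted by both erosions. -/
lemma ErosionProfile.sup_eq (hP : ErosionProfile F y k H e) (hP' : ErosionProfile F y' k' H' e')
    (hk : k ≠ k') : H ⊔ H' = F := by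
  refine le_antisymm (sup_le hP.le hP'.le) fun u v huv => ?_
  by_contra hc
  rw [sup_adj, not_or] at hc
  rcases hP.deleted u v huv hc.1 with h | h <;> rcases hP'.deleted u v huv hc.2 with h' | h'
  · exact hk (h.2.symm.trans h'.2)
  · exact hk (h.2.symm.trans ((connectedComponentMk_eq_of_adj huv h.1 h'.1).trans h'.2))
  · exact hk (h.2.symm.trans ((connectedComponentMk_eq_of_adj huv h'.1 h.1).symm.trans h'.2))
  · exact hk (h.2.symm.trans h'.2)

variable [Finite V]

lemma Erosion.profile (hy : 3 ≤ F.valence y) (h : Erosion F y k H e) :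
    ErosionProfile F y k H e := by
  induction h with
  | @start z h hz hk =>
    have hyz : y ≠ z := h.ne
    refine ⟨sdiff_le, fun u v huv huv' => ?_, hz, ?_, hk, fun v hv hv2 => ?_, fun v hvy hv2 => ?_,
      valence_sdiff_edge_left h⟩
    · simp only [sdiff_adj, edge_adj, huv, true_and, not_not] at huv'
      rcases huv'.1 with ⟨-, rfl⟩ | ⟨rfl, -⟩
      · exact Or.inr ⟨hz, hk⟩
      · exact Or.inl ⟨hz, hk⟩
    · have := valence_sdiff_edge_right h
      omega
    · rw [valence_sdiff_edge_of_ne (by rintro rfl; omega) hv]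
      exact Or.inl hv2
    · exact valence_sdiff_edge_of_ne hvy (by rintro rfl; omega)
  | @step H e e' hH h he' ih =>
    have hne : e ≠ e' := h.ne
    have hye : y ≠ e := by rintro rfl; have := ih.valence_end; omega
    have hye' : y ≠ e' := by rintro rfl; omega
    have hk : F.threadGraph.connectedComponentMk e' = k := by
      rw [← ih.mk_end]
      exact (connectedComponentMk_eq_of_adj (ih.le h) ih.valence_end he').symm
    have h1 := valence_sdiff_edge_left h
    have h2 := valence_sdiff_edge_right h
    have h3 := ih.valence_end'
    refine ⟨sdiff_le.trans ih.le, fun u v huv huv' => ?_, he', ?_, hk, fun v hv hv2 => ?_,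
      fun v hvy hv2 => ?_, ?_⟩
    · by_cases hH : H.Adj u v
      · simp only [sdiff_adj, edge_adj, hH, true_and, not_not] at huv'
        rcases huv'.1 with ⟨-, rfl⟩ | ⟨rfl, -⟩
        · exact Or.inr ⟨he', hk⟩
        · exact Or.inl ⟨he', hk⟩
      · exact ih.deleted u v huv hH
    · rcases ih.valence_two e' hne.symm he' with h4 | h4
      · omega
      · exact absurd h4.1 h.symm.valence_pos.ne'
    · by_cases hve : v = e
      · subst hve
        exact Or.inr ⟨by omega, ih.mk_end⟩
      · rw [valence_sdiff_edge_of_ne hve hv]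
        exact ih.valence_two v hve hv2
    · rw [valence_sdiff_edge_of_ne (by rintro rfl; exact hv2 ih.valence_end)
        (by rintro rfl; exact hv2 he')]
      exact ih.valence_ne_two v hvy hv2
    · rw [valence_sdiff_edge_of_ne hye hye']
      exact ih.valence_source

lemma isolatedSet_sdiff_edge (h : H.Adj e e') (he : H.valence e = 1) (he' : 2 ≤ H.valence e') :
    (H \ edge e e').isolatedSet = insert e H.isolatedSet := by
  have h1 := valence_sdiff_edge_left h
  have h2 := valence_sdiff_edge_right h
  ext v
  simp only [Set.mem_insert_iff, mem_isolatedSet]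
  by_cases hv : v = e
  · subst hv; simp only [true_or, iff_true]; omega
  · by_cases hv' : v = e'
    · subst hv'; simp only [hv, false_or]; omega
    · rw [valence_sdiff_edge_of_ne hv hv']; simp [hv]

namespace ErosionProfile

lemma two_le_valence_of_adj (hP : ErosionProfile F y k H e) (h : H.Adj e e')
    (he' : F.valence e' = 2) : 2 ≤ H.valence e' := by
  rcases hP.valence_two e' h.ne.symm he' with h4 | h4
  · exact h4.ge
  · exact absurd h4.1 h.symm.valence_pos.ne'

lemma isolatedSet_subset (hP : ErosionProfile F y k H e) : F.isolatedSet ⊆ H.isolatedSet :=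
  isolatedSet_anti hP.le

end ErosionProfile

lemma isolatedSet_erosion_start {z : V} (hy : 3 ≤ F.valence y) (h : F.Adj y z)
    (hz : F.valence z = 2) : (F \ edge y z).isolatedSet = F.isolatedSet := by
  have h1 := valence_sdiff_edge_left h
  have h2 := valence_sdiff_edge_right h
  ext v
  simp only [mem_isolatedSet]
  by_cases hv : v = y
  · subst hv; omega
  · by_cases hv' : v = z
    · subst hv'; omega
    · rw [valence_sdiff_edge_of_ne hv hv']

lemma Erosion.isolatedSet_step (hy : 3 ≤ F.valence y) (hE : Erosion F y k H e) (h : H.Adj e e')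
    (he' : F.valence e' = 2) : (H \ edge e e').isolatedSet = insert e H.isolatedSet :=
  isolatedSet_sdiff_edge h (hE.profile hy).valence_end' ((hE.profile hy).two_le_valence_of_adj h he')

/-- Erosion continues until the next vertex raises the independence number. The loose end has degree
`1`, so it has a next neighbour: either erosion can go on, or the other end of the thread is reached
and `h1` supplies the gain. -/
lemma Erosion.exists_gain {z : V} (hy : 3 ≤ F.valence y) (h : F.Adj y z) (hz : F.valence z = 2)
    (hk : F.threadGraph.connectedComponentMk z = k)
    (h1 : ∀ H e e', Erosion F y k H e → G.indepOn H.isolatedSet ≤ G.indepOn F.isolatedSet →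
      H.Adj e e' → F.valence e' ≠ 2 → G.indepOn F.isolatedSet < G.indepOn (insert e H.isolatedSet)) :
    ∃ H e, Erosion F y k H e ∧ G.indepOn H.isolatedSet ≤ G.indepOn F.isolatedSet ∧
      G.indepOn F.isolatedSet < G.indepOn (insert e H.isolatedSet) := by
  suffices ∀ n H e, Erosion F y k H e → G.indepOn H.isolatedSet ≤ G.indepOn F.isolatedSet →
      (H.isolatedSetᶜ).ncard = n → ∃ H e, Erosion F y k H e ∧
        G.indepOn H.isolatedSet ≤ G.indepOn F.isolatedSet ∧
          G.indepOn F.isolatedSet < G.indepOn (insert e H.isolatedSet) from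
    this _ _ _ (Erosion.start h hz hk) (by rw [isolatedSet_erosion_start hy h hz]) rfl
  intro n
  induction n using Nat.strong_induction_on with
  | _ n ih =>
    intro H e hE ha hn
    have hP := hE.profile hy
    by_cases hlt : G.indepOn F.isolatedSet < G.indepOn (insert e H.isolatedSet)
    · exact ⟨H, e, hE, ha, hlt⟩
    obtain ⟨e', he'⟩ : ∃ e', H.Adj e e' := by
      by_contra hc
      push Not at hc
      have := valence_eq_zero.2 hc
      have := hP.valence_end'
      omega
    by_cases h2 : F.valence e' = 2
    · have hZ := hE.isolatedSet_step hy he' h2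
      refine ih _ ?_ _ _ (hE.step he' h2) (by rw [hZ]; omega) rfl
      rw [hZ, ← hn]
      refine Set.ncard_lt_ncard (compl_lt_compl_iff_lt.2 ?_)
      exact Set.ssubset_insert hP.end_notMem
    · exact absurd (h1 H e e' hE ha he' h2) hlt

/-- Two different threads are eroded, and the two ends that are left over are joined by a path
through uncovered vertices. -/
lemma ErosionProfile.exists_join (hP : ErosionProfile F y k H e)
    (hP' : ErosionProfile F y' k' H' e') (hy : 3 ≤ F.valence y) (hy' : 3 ≤ F.valence y')
    (hk : k ≠ k') (hF : F ≤ G)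
    (hl : G.Linked F.isolatedSet e e') :
    ∃ F' ≤ G, F'.isolatedSet ⊆ H.isolatedSet ∪ H'.isolatedSet ∧
      (∀ v, F.valence v = 0 ∨ F.valence v = 2 → F'.valence v = 0 ∨ F'.valence v = 2) ∧
      (∀ v, F.valence v ≠ 0 → F.valence v ≠ 2 → v ≠ y → v ≠ y' → F'.valence v = F.valence v) ∧
      (y ≠ y' → F'.valence y + 1 = F.valence y ∧ F'.valence y' + 1 = F.valence y') ∧
      (y = y' → F'.valence y + 2 = F.valence y) ∧
      (∀ v, F.valence v = 0 → F'.valence v ≠ 0 →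
        G.Linked F.isolatedSet e v) := by
  classical
  obtain ⟨p, hp, hps⟩ := hl.exists_isPath
  -- No edge is deleted twice, so the degree losses of the two erosions add up in `H ⊓ H'`.
  have hsum := valence_add_valence_inf (hP.sup_eq hP' hk)
  have hee : e ≠ e' := by rintro rfl; exact hk (hP.mk_end.symm.trans hP'.mk_end)
  have hHe : (H ⊓ H').valence e = 1 := by
    have h1 := hsum e
    rw [hP.valence_end, hP.valence_end'] at h1
    rcases hP'.valence_two e hee hP.valence_end with h2 | h2
    · omega
    · exact absurd (hP.mk_end.symm.trans h2.2) hk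
  have hHe' : (H ⊓ H').valence e' = 1 := by
    have h1 := hsum e'
    rw [hP'.valence_end, hP'.valence_end'] at h1
    rcases hP.valence_two e' hee.symm hP'.valence_end with h2 | h2
    · omega
    · exact absurd (hP'.mk_end.symm.trans h2.2) hk.symm
  have hfar : ∀ v, F.valence v ≠ 2 → v ≠ y → v ≠ y' → (H ⊓ H').valence v = F.valence v := by
    intro v h2 h3 h4
    have h1 := hsum v
    rw [hP.valence_ne_two v h3 h2, hP'.valence_ne_two v h4 h2] at h1
    omega
  have hdeg : ∀ v, v ≠ e → v ≠ e' → F.valence v = 2 →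
      (H ⊓ H').valence v = 2 ∨ ((H ⊓ H').valence v = 0 ∧ (H.valence v = 0 ∨ H'.valence v = 0)) := by
    intro v h2 h3 h4
    have h1 := hsum v
    rcases hP.valence_two v h2 h4 with h5 | h5 <;> rcases hP'.valence_two v h3 h4 with h6 | h6
    · omega
    · omega
    · omega
    · exact absurd (h5.2.symm.trans h6.2) hk
  have hle : H ⊓ H' ≤ F := inf_le_left.trans hP.le
  obtain ⟨F', hF'G, hHF', h1, h2, h3, h4⟩ := exists_add_path (H := H ⊓ H') p hp hee
    (hle.trans hF)
    (fun _ hadj => hk (hP.mk_end.symm.trans ((connectedComponentMk_eq_of_adj (hle hadj)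
      hP.valence_end hP'.valence_end).trans hP'.mk_end)))
    (fun x hx hxe hxe' => isolatedSet_anti hle (((hps x hx).resolve_left hxe).resolve_left hxe'))
  rw [hHe] at h1
  rw [hHe'] at h2
  have hint : ∀ v ∈ p.support, F.valence v ≠ 0 → v = e ∨ v = e' := by
    intro v hv hv0
    rcases hps v hv with h | h | h
    · exact Or.inl h
    · exact Or.inr h
    · exact absurd h hv0
  have hbig : ∀ v, F.valence v ≠ 0 → F.valence v ≠ 2 → F'.valence v = (H ⊓ H').valence v := by
    intro v hv0 hv2
    refine h4 v fun hv => ?_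
    rcases hint v hv hv0 with rfl | rfl
    · exact hv2 hP.valence_end
    · exact hv2 hP'.valence_end
  refine ⟨F', hF'G, ?_, ?_, ?_, ?_, ?_, ?_⟩
  · intro v hv
    rw [mem_isolatedSet] at hv
    rcases eq_or_ne v e with rfl | hve
    · omega
    rcases eq_or_ne v e' with rfl | hve'
    · omega
    by_cases hvp : v ∈ p.support
    · have := h3 v hvp hve hve'; omega
    rw [h4 v hvp] at hv
    by_cases hv2 : F.valence v = 2
    · rcases hdeg v hve hve' hv2 with h | h
      · omega
      · exact h.2
    · by_cases hvy : v = y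
      · subst hvy
        have ha := hsum v
        have hb := hP.valence_source
        by_cases hyy' : v = y'
        · subst hyy'
          have hb' := hP'.valence_source
          omega
        · have := hP'.valence_ne_two v hyy' hv2
          omega
      · left
        have ha := hsum v
        rw [mem_isolatedSet, hP.valence_ne_two v hvy hv2]
        by_cases hyy' : v = y'
        · subst hyy'
          have hb' := hP'.valence_source
          have := hP.valence_ne_two v hvy hv2
          omega
        · rw [← hfar v hv2 hvy hyy', hv]
  · rintro v hv
    rcases eq_or_ne v e with rfl | hve
    · omega
    rcases eq_or_ne v e' with rfl | hve'
    · omega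
    by_cases hvp : v ∈ p.support
    · exact Or.inr (h3 v hvp hve hve')
    rw [h4 v hvp]
    rcases hv with hv | hv
    · left
      have := valence_mono hle v
      omega
    · rcases hdeg v hve hve' hv with h | h
      · exact Or.inr h
      · exact Or.inl h.1
  · intro v hv0 hv2 hvy hvy'
    rw [hbig v hv0 hv2, hfar v hv2 hvy hvy']
  · intro hne
    rw [hbig y (by omega) (by omega), hbig y' (by omega) (by omega)]
    have ha := hsum y
    have ha' := hsum y'
    have hb := hP.valence_source
    have hb' := hP'.valence_source
    have hc := hP.valence_ne_two y' hne.symm (by omega)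
    have hc' := hP'.valence_ne_two y hne (by omega)
    omega
  · rintro rfl
    rw [hbig y (by omega) (by omega)]
    have ha := hsum y
    have hb := hP.valence_source
    have hb' := hP'.valence_source
    omega
  · intro v hv hv'
    have hvp : v ∈ p.support := by
      by_contra hvp
      rw [h4 v hvp] at hv'
      have := valence_mono hle v
      omega
    -- The initial segment of `p` is the required link; it avoids `e'` unless `v = e'`.
    refine ⟨p.takeUntil v hvp, fun x hx => ?_⟩
    rcases hps x (p.support_takeUntil_subset_support hvp hx) with h | rfl | h
    · exact Or.inl h
    · right; left
      by_contra hne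
      exact Walk.endpoint_notMem_support_takeUntil hp hvp hne hx
    · exact Or.inr (Or.inr h)

/-- The parts removed by eroding two different threads are not linked through the uncovered
vertices, provided that the ends are never linked. -/
lemma Erosion.not_linked (hy : 3 ≤ F.valence y) (hy' : 3 ≤ F.valence y')
    (h2 : ∀ H e H' e', Erosion F y k H e → Erosion F y' k' H' e' →
      G.indepOn (H.isolatedSet ∪ H'.isolatedSet) ≤ G.indepOn F.isolatedSet →
      ¬G.Linked F.isolatedSet e e')
    (hE : Erosion F y k H e) (hE' : Erosion F y' k' H' e')
    (ha : G.indepOn H.isolatedSet ≤ G.indepOn F.isolatedSet)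
    (ha' : G.indepOn H'.isolatedSet ≤ G.indepOn F.isolatedSet) :
    ∀ x ∈ insert e (H.isolatedSet \ F.isolatedSet),
      ∀ x' ∈ insert e' (H'.isolatedSet \ F.isolatedSet), ¬G.Linked F.isolatedSet x x' := by
  have union_le : ∀ {H H' : SimpleGraph V}, F.isolatedSet ⊆ H.isolatedSet →
      F.isolatedSet ⊆ H'.isolatedSet →
      G.indepOn H.isolatedSet ≤ G.indepOn F.isolatedSet →
      G.indepOn H'.isolatedSet ≤ G.indepOn F.isolatedSet →
      (∀ x ∈ H.isolatedSet \ F.isolatedSet, ∀ x' ∈ H'.isolatedSet \ F.isolatedSet,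
        ¬G.Linked F.isolatedSet x x') →
      G.indepOn (H.isolatedSet ∪ H'.isolatedSet) ≤ G.indepOn F.isolatedSet := by
    intro H H' hs hs' h h' hun
    have := indepOn_union_union_le hun (by rwa [Set.union_sdiff_cancel hs])
      (by rwa [Set.union_sdiff_cancel hs'])
    rwa [Set.union_union_distrib_left, Set.union_sdiff_cancel hs,
      Set.union_sdiff_cancel hs'] at this
  -- Only the pair of ends is new. The parts removed before them are unlinked, so by `union_le`
  -- their union does not raise the independence number, and `h2` applies.
  have key : ∀ {H H' : SimpleGraph V} {e e' : V}, Erosion F y k H e → Erosion F y' k' H' e' →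
      G.indepOn H.isolatedSet ≤ G.indepOn F.isolatedSet →
      G.indepOn H'.isolatedSet ≤ G.indepOn F.isolatedSet →
      (∀ x ∈ H.isolatedSet \ F.isolatedSet, ∀ x' ∈ insert e' (H'.isolatedSet \ F.isolatedSet),
        ¬G.Linked F.isolatedSet x x') →
      (∀ x ∈ insert e (H.isolatedSet \ F.isolatedSet), ∀ x' ∈ H'.isolatedSet \ F.isolatedSet,
        ¬G.Linked F.isolatedSet x x') →
      ∀ x ∈ insert e (H.isolatedSet \ F.isolatedSet),
        ∀ x' ∈ insert e' (H'.isolatedSet \ F.isolatedSet), ¬G.Linked F.isolatedSet x x' := by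
    intro H H' e e' hE hE' ha ha' hl hr x hx x' hx'
    rcases hx with rfl | hx
    · rcases hx' with rfl | hx'
      · exact h2 _ _ _ _ hE hE' (union_le (hE.profile hy).isolatedSet_subset
          (hE'.profile hy').isolatedSet_subset ha ha'
          fun x hx x' hx' => hl x hx x' (Or.inr hx'))
      · exact hr _ (Or.inl rfl) _ hx'
    · exact hl x hx x' hx'
  have step_eq : ∀ {y : V} {k : F.threadGraph.ConnectedComponent} {H : SimpleGraph V} {e e' : V},
      3 ≤ F.valence y → Erosion F y k H e → H.Adj e e' → F.valence e' = 2 →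
      (H \ edge e e').isolatedSet \ F.isolatedSet = insert e (H.isolatedSet \ F.isolatedSet) := by
    intro y k H e e' hy hE h h2
    rw [hE.isolatedSet_step hy h h2, Set.insert_sdiff_of_notMem]
    rw [mem_isolatedSet, (hE.profile hy).valence_end]; omega
  -- Double induction over both erosions. By `step_eq`, the part removed by a step is the previous
  -- part together with its end, so shorter pairs of erosions settle all but the two current ends.
  induction hE generalizing H' e' with
  | start h hz hk =>
    induction hE' with
    | start h' hz' hk' =>
      refine key (.start h hz hk) (.start h' hz' hk') ha ha' ?_ ?_ <;>
        simp [isolatedSet_erosion_start hy h hz, isolatedSet_erosion_start hy' h' hz']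
    | step hE' h' he' ih =>
      refine key (.start h hz hk) (.step hE' h' he') ha ha' ?_ ?_
      · simp [isolatedSet_erosion_start hy h hz]
      · rw [step_eq hy' hE' h' he']
        refine ih ((indepOn_mono ?_).trans ha')
        rw [hE'.isolatedSet_step hy' h' he']
        exact Set.subset_insert _ _
  | @step H _ _ hE h he ih =>
    have hmono : G.indepOn H.isolatedSet ≤ G.indepOn F.isolatedSet := (indepOn_mono (by
        rw [hE.isolatedSet_step hy h he]
        exact Set.subset_insert _ _)).trans ha
    induction hE' with
    | start h' hz' hk' =>
      refine key (.step hE h he) (.start h' hz' hk') ha ha' ?_ ?_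
      · rw [step_eq hy hE h he]
        exact ih (.start h' hz' hk') hmono ha'
      · simp [isolatedSet_erosion_start hy' h' hz']
    | step hE' h' he' ih' =>
      refine key (.step hE h he) (.step hE' h' he') ha ha' ?_ ?_
      · rw [step_eq hy hE h he]
        exact ih (.step hE' h' he') hmono ha'
      · rw [step_eq hy' hE' h' he']
        refine ih' ((indepOn_mono ?_).trans ha')
        rw [hE'.isolatedSet_step hy' h' he']
        exact Set.subset_insert _ _

end Erosion

/-! ### Counting threads and adding their gains. -/

section Threads

variable {V : Type*} {F : SimpleGraph V}

lemma valence_eq_two_of_mk_eq {u v : V} (hu : F.valence u = 2)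
    (h : F.threadGraph.connectedComponentMk v = F.threadGraph.connectedComponentMk u) :
    F.valence v = 2 := by
  obtain ⟨p⟩ := ConnectedComponent.exact h
  cases p with
  | nil => exact hu
  | cons h _ => exact h.2.1

variable [Fintype V]

/-- A connected graph on `n` vertices has at least `n - 1` edges; apply the handshake lemma. -/
lemma two_mul_ncard_supp_le (C : F.ConnectedComponent) :
    2 * C.supp.ncard ≤ (∑ᶠ v ∈ C.supp, F.valence v) + 2 := by
  classical
  have h1 := C.connected_toSimpleGraph.card_vert_le_card_edgeSet_add_one
  have h2 := C.toSimpleGraph.sum_degrees_eq_twice_card_edges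
  rw [Nat.card_eq_fintype_card] at h1
  have h3 : C.supp.ncard = Fintype.card C.supp := by
    rw [← Nat.card_coe_set_eq, Nat.card_eq_fintype_card]
  have h4 : 2 * C.toSimpleGraph.edgeFinset.card ≤ ∑ v : C, F.valence v := by
    rw [← h2]
    refine Finset.sum_le_sum fun v _ => ?_
    rw [← card_neighborSet_eq_degree, ← Nat.card_eq_fintype_card, Nat.card_coe_set_eq, valence,
      ← Set.ncard_image_of_injective _ Subtype.val_injective]
    refine Set.ncard_le_ncard ?_
    rintro _ ⟨w, hw, rfl⟩
    exact hw
  have h5 : ∑ᶠ v ∈ C.supp, F.valence v = ∑ v : C, F.valence v := by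
    rw [← finsum_eq_sum_of_fintype]
    exact (finsum_set_coe_eq_finsum_mem C.supp).symm
  have h6 : Fintype.card C.supp = Fintype.card C := Fintype.card_congr (Equiv.refl _)
  have h7 : Nat.card C.toSimpleGraph.edgeSet = C.toSimpleGraph.edgeFinset.card := by
    rw [Nat.card_eq_fintype_card, edgeFinset_card]
  omega

open Classical in
/-- The threads of `F` with an end in `Y`. -/
noncomputable def threadsAt (F : SimpleGraph V) (Y : Finset V) :
    Finset F.threadGraph.ConnectedComponent :=
  Finset.univ.filter fun k => ∃ y ∈ Y, ∃ z, F.Adj y z ∧ F.threadGraph.connectedComponentMk z = k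

open Classical in
/-- A thread has at most two ends. -/
lemma card_thread_ends_le (Y : Finset V) (hY : ∀ y ∈ Y, 3 ≤ F.valence y)
    (hY' : ∀ y ∈ Y, ∀ z, F.Adj y z → F.valence z = 2) (k : F.threadGraph.ConnectedComponent) :
    ((Finset.univ : Finset (V × V)).filter fun d =>
      (d.1 ∈ Y ∧ F.Adj d.1 d.2) ∧ F.threadGraph.connectedComponentMk d.2 = k).card ≤ 2 := by
  set D := (Finset.univ : Finset (V × V)).filter fun d =>
      (d.1 ∈ Y ∧ F.Adj d.1 d.2) ∧ F.threadGraph.connectedComponentMk d.2 = k with hD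
  rcases D.eq_empty_or_nonempty with h0 | ⟨d, hd⟩
  · rw [h0]; simp
  rw [hD, Finset.mem_filter] at hd
  have hk2 : ∀ z ∈ k.supp, F.valence z = 2 := fun z hz =>
    valence_eq_two_of_mk_eq (hY' _ hd.2.1.1 _ hd.2.1.2) (Eq.trans hz hd.2.2.symm)
  have hmaps : ∀ d ∈ D, d.2 ∈ k.supp.toFinset := by
    intro d hd
    rw [hD, Finset.mem_filter] at hd
    simpa using hd.2.2
  have hcard := Finset.card_eq_sum_card_fiberwise hmaps
  -- A thread vertex has degree `2` in `F`, shared between edges to `Y` and edges of the thread.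
  -- Since the thread degrees sum to at least `2n - 2` on `n` vertices, at most two edges go to `Y`.
  have hfib : ∀ z ∈ k.supp.toFinset,
      (D.filter fun d => d.2 = z).card + F.threadGraph.valence z ≤ 2 := by
    intro z hz
    rw [Set.mem_toFinset] at hz
    have h1 : (D.filter fun d => d.2 = z).card = {y | y ∈ Y ∧ F.Adj y z}.ncard := by
      rw [← Set.ncard_coe_finset]
      rw [show {y | y ∈ Y ∧ F.Adj y z} = Prod.fst '' (↑(D.filter fun d => d.2 = z) : Set (V × V)) by
        ext y
        simp only [hD, Set.mem_ofPred_eq, Finset.coe_filter, Finset.mem_filter, Finset.mem_univ,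
          true_and, Set.mem_image, Prod.exists, exists_and_right, exists_eq_right]
        constructor
        · exact fun h => ⟨h, hz⟩
        · exact fun h => h.1]
      refine (Set.InjOn.ncard_image ?_).symm
      rintro ⟨a, c⟩ ha ⟨a', c'⟩ ha' h
      simp only [Finset.coe_filter, Set.mem_ofPred_eq] at ha ha' h
      rw [h, ha.2, ha'.2]
    rw [h1, ← hk2 z hz, valence, valence, ← Set.ncard_union_eq]
    · refine Set.ncard_le_ncard ?_
      rintro y (hy | hy)
      · exact hy.2.symm
      · exact hy.1
    · rw [Set.disjoint_left]
      intro y hy hy'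
      have := hY y hy.1
      have := hy'.2.2
      omega
  have hsum := Finset.sum_le_sum hfib
  rw [Finset.sum_add_distrib, ← hcard, Finset.sum_const, smul_eq_mul] at hsum
  have h1 := two_mul_ncard_supp_le k
  rw [Set.ncard_eq_toFinset_card', finsum_mem_eq_finite_toFinset_sum _ k.supp.toFinite,
    Set.toFinite_toFinset] at h1
  omega

lemma sum_valence_le_two_mul_card_threadsAt (Y : Finset V) (hY : ∀ y ∈ Y, 3 ≤ F.valence y)
    (hY' : ∀ y ∈ Y, ∀ z, F.Adj y z → F.valence z = 2) :
    ∑ y ∈ Y, F.valence y ≤ 2 * (F.threadsAt Y).card := by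
  classical
  let D := (Finset.univ : Finset (V × V)).filter fun d => d.1 ∈ Y ∧ F.Adj d.1 d.2
  have hD : D.card = ∑ y ∈ Y, F.valence y := by
    rw [Finset.card_eq_sum_card_fiberwise (f := Prod.fst) (t := Y)
      (fun d hd => (Finset.mem_filter.1 hd).2.1)]
    refine Finset.sum_congr rfl fun y hy => ?_
    rw [valence, ← Set.ncard_coe_finset]
    rw [show F.neighborSet y = Prod.snd '' (↑(D.filter fun d => d.1 = y) : Set (V × V)) by
      ext z
      simp only [D, mem_neighborSet, Finset.coe_filter, Finset.mem_filter, Finset.mem_univ,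
        true_and, Set.mem_image, Set.mem_ofPred_eq, Prod.exists]
      constructor
      · exact fun h => ⟨y, z, ⟨⟨hy, h⟩, rfl⟩, rfl⟩
      · rintro ⟨a, c, ⟨⟨-, h⟩, rfl⟩, rfl⟩; exact h]
    refine (Set.InjOn.ncard_image ?_).symm
    rintro ⟨a, c⟩ ha ⟨a', c'⟩ ha' h
    simp only [Finset.coe_filter, Set.mem_ofPred_eq] at ha ha' h
    rw [h, ha.2, ha'.2]
  rw [← hD]
  refine Finset.card_le_mul_card_image_of_maps_to
    (f := fun d => F.threadGraph.connectedComponentMk d.2) ?_ 2 ?_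
  · intro d hd
    have := (Finset.mem_filter.1 hd).2
    exact Finset.mem_filter.2 ⟨Finset.mem_univ _, d.1, this.1, d.2, this.2, rfl⟩
  · intro k _
    rw [Finset.filter_filter]
    exact card_thread_ends_le Y hY hY' k

/-- If every erosion of a thread starting in `Y` gains an independent vertex before it reaches the
other end of the thread, and the ends of two eroded threads are never linked, then each thread
with an end in `Y` contributes to the independence number. -/
lemma indepOn_add_card_threadsAt_le {G : SimpleGraph V} (Y : Finset V)
    (hY : ∀ y ∈ Y, 3 ≤ F.valence y) (hY' : ∀ y ∈ Y, ∀ z, F.Adj y z → F.valence z = 2)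
    (h1 : ∀ y ∈ Y, ∀ k H e e', Erosion F y k H e →
      G.indepOn H.isolatedSet ≤ G.indepOn F.isolatedSet → H.Adj e e' → F.valence e' ≠ 2 →
      G.indepOn F.isolatedSet < G.indepOn (insert e H.isolatedSet))
    (h2 : ∀ y ∈ Y, ∀ y' ∈ Y, ∀ k k', k ≠ k' → ∀ H e H' e', Erosion F y k H e →
      Erosion F y' k' H' e' →
      G.indepOn (H.isolatedSet ∪ H'.isolatedSet) ≤ G.indepOn F.isolatedSet →
      ¬G.Linked F.isolatedSet e e') :
    G.indepOn F.isolatedSet + (F.threadsAt Y).card ≤ G.indepNum := by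
  classical
  have hex : ∀ k ∈ F.threadsAt Y, ∃ y ∈ Y, ∃ H e, Erosion F y k H e ∧
      G.indepOn H.isolatedSet ≤ G.indepOn F.isolatedSet ∧
      G.indepOn F.isolatedSet < G.indepOn (insert e H.isolatedSet) := by
    intro k hk
    obtain ⟨y, hy, z, hz, hkz⟩ := (Finset.mem_filter.1 hk).2
    exact ⟨y, hy, Erosion.exists_gain (hY y hy) hz (hY' y hy z hz) hkz (h1 y hy k)⟩
  rcases (F.threadsAt Y).eq_empty_or_nonempty with h0 | ⟨k₀, hk₀⟩
  · rw [h0, ← indepOn_univ, Finset.card_empty]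
    exact indepOn_mono (Set.subset_univ _)
  have : Nonempty V := ⟨(hex k₀ hk₀).choose⟩
  choose! y hyY H e hE hle hlt using hex
  rw [← indepOn_univ]
  refine (indepOn_add_card_le (F.threadsAt Y)
    (fun k => insert (e k) ((H k).isolatedSet \ F.isolatedSet)) ?_ ?_).trans
      (indepOn_mono (Set.subset_univ _))
  · intro k hk k' hk' hkk'
    exact Erosion.not_linked (hY _ (hyY k hk)) (hY _ (hyY k' hk'))
      (h2 _ (hyY k hk) _ (hyY k' hk') k k' hkk') (hE k hk) (hE k' hk') (hle k hk) (hle k' hk')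
  · intro k hk
    rw [Set.union_insert, Set.union_sdiff_cancel
      ((hE k hk).profile (hY _ (hyY k hk))).isolatedSet_subset]
    exact hlt k hk

end Threads

/-! ### Absorbing a path of uncovered vertices. -/

section Absorb

variable {V : Type*} [Fintype V] {G F H : SimpleGraph V} {b : ℕ} {x₁ x₂ t₁ t₂ : V}

/-- A path of isolated vertices of `H` is added to `H`, together with edges joining its ends to the
rest of `H`. -/
lemma exists_absorb (hH : H ≤ G) (p : G.Walk x₁ x₂) (hp : p.IsPath)
    (hps : ∀ x ∈ p.support, x ∈ H.isolatedSet) (ht₁ : t₁ ∉ H.isolatedSet)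
    (ht₂ : t₂ ∉ H.isolatedSet) (h₁ : G.Adj t₁ x₁) (h₂ : G.Adj x₂ t₂) (hne : t₁ = t₂ → x₁ ≠ x₂) :
    ∃ F ≤ G, H ≤ F ∧ (∀ x ∈ p.support, F.valence x = 2) ∧
      (t₁ ≠ t₂ → F.valence t₁ = H.valence t₁ + 1 ∧ F.valence t₂ = H.valence t₂ + 1) ∧
      (t₁ = t₂ → F.valence t₁ = H.valence t₁ + 2) ∧
      (∀ v ∉ p.support, v ≠ t₁ → v ≠ t₂ → F.valence v = H.valence v) := by
  have hx₁ : H.valence x₁ = 0 := hps x₁ p.start_mem_support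
  have hadj : ¬H.Adj t₁ x₁ := fun h => valence_eq_zero.1 hx₁ _ h.symm
  have hx₁t₂ : x₁ ≠ t₂ := by rintro rfl; exact ht₂ hx₁
  have ht₁p : t₁ ∉ p.support := fun h => ht₁ (hps _ h)
  have ht₂p : t₂ ∉ p.support := fun h => ht₂ (hps _ h)
  obtain ⟨F, hFG, hHF, e1, e2, e3, e4⟩ := exists_add_path (H := H ⊔ edge t₁ x₁) (p.concat h₂)
    (hp.concat ht₂p h₂) hx₁t₂ (sup_le hH (by rw [edge_le_iff]; exact Or.inr h₁)) (by
      intro hlen hA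
      rw [Walk.length_concat, Nat.add_eq_right] at hlen
      rw [sup_edge_adj' h₁.ne] at hA
      rcases hA with hA | hA | hA
      · exact valence_eq_zero.1 hx₁ _ hA
      · exact hx₁t₂ hA.2.symm
      · exact hne hA.2.symm (Walk.eq_of_length_eq_zero hlen)) (by
      intro x hx hx1 hx2
      rw [Walk.support_concat, List.mem_append, List.mem_singleton] at hx
      have hxp := hx.resolve_right hx2
      rw [mem_isolatedSet, valence_sup_edge_of_ne (by rintro rfl; exact ht₁p hxp) hx1]
      exact hps x hxp)
  rw [valence_sup_edge_right hadj h₁.ne, hx₁] at e1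
  refine ⟨F, hFG, le_sup_left.trans hHF, ?_, ?_, ?_, ?_⟩
  · intro x hx
    by_cases hx1 : x = x₁
    · rw [hx1, e1]
    · exact e3 x (by rw [Walk.support_concat]; exact List.mem_append_left _ hx) hx1
        (by rintro rfl; exact ht₂p hx)
  · intro ht
    rw [e2, valence_sup_edge_of_ne ht.symm hx₁t₂.symm, e4 t₁, valence_sup_edge_left hadj h₁.ne]
    · exact ⟨rfl, rfl⟩
    · rw [Walk.support_concat, List.mem_append, List.mem_singleton, not_or]
      exact ⟨ht₁p, ht⟩
  · rintro rfl
    rw [e2, valence_sup_edge_left hadj h₁.ne]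
  · intro v hv hv1 hv2
    rw [e4 v, valence_sup_edge_of_ne hv1]
    · rintro rfl; exact hv p.start_mem_support
    · rw [Walk.support_concat, List.mem_append, List.mem_singleton, not_or]
      exact ⟨hv, hv2⟩

/-- An optimal graph does not admit the absorption of a path that contains all uncovered
neighbours of its first vertex. -/
lemma IsOptimal.not_absorb (hF : G.IsOptimal F b) (hb : 2 ≤ b) (hH : H ≤ G)
    (ha : G.indepOn H.isolatedSet ≤ G.indepOn F.isolatedSet) (p : G.Walk x₁ x₂) (hp : p.IsPath)
    (hps : ∀ x ∈ p.support, x ∈ H.isolatedSet)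
    (hx₁ : ∀ w ∈ H.isolatedSet, G.Adj x₁ w → w ∈ p.support)
    (h₁ : G.Adj t₁ x₁) (h₂ : G.Adj x₂ t₂)
    (hdeg : ∀ v, v ≠ t₁ → v ≠ t₂ → H.valence v = 0 ∨ 2 ≤ H.valence v ∧ H.valence v ≤ b)
    (ht₁ : 1 ≤ H.valence t₁) (ht₂ : 1 ≤ H.valence t₂)
    (hne : t₁ ≠ t₂ → H.valence t₁ < b ∧ H.valence t₂ < b)
    (heq : t₁ = t₂ → x₁ ≠ x₂ ∧ H.valence t₁ + 2 ≤ b) : False := by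
  have ht₁' : t₁ ∉ H.isolatedSet := by rw [mem_isolatedSet]; omega
  have ht₂' : t₂ ∉ H.isolatedSet := by rw [mem_isolatedSet]; omega
  obtain ⟨F', hF'G, hHF', e1, e2, e3, e4⟩ := exists_absorb hH p hp hps ht₁' ht₂' h₁ h₂
    fun h => (heq h).1
  have hgood : F'.IsDegGraph b := by
    intro v
    by_cases hvp : v ∈ p.support
    · rw [e1 v hvp]; omega
    by_cases hv1 : v = t₁
    · subst hv1
      by_cases ht : v = t₂
      · have := e3 ht; have := heq ht; omega
      · have := e2 ht; have := hne ht; omega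
    by_cases hv2 : v = t₂
    · subst hv2
      have := e2 (Ne.symm hv1); have := hne (Ne.symm hv1); omega
    rw [e4 v hvp hv1 hv2]
    exact hdeg v hv1 hv2
  have h := hF.indepOn_le F' hF'G hgood
  -- All neighbours of `x₁` isolated in `H` lie on `p`, so `x₁` extends every independent set of
  -- vertices still uncovered.
  have h' : G.indepOn F'.isolatedSet < G.indepOn H.isolatedSet := by
    have key : ∀ w ∈ F'.isolatedSet, w ∉ p.support := by
      intro w hw hwp
      rw [mem_isolatedSet, e1 w hwp] at hw
      omega
    exact indepOn_lt (isolatedSet_anti hHF') (hps _ p.start_mem_support)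
      (fun hx => key _ hx p.start_mem_support)
      fun w hw hadj => key w hw (hx₁ w (isolatedSet_anti hHF' hw) hadj)
  omega

/-- Deleting an edge between two vertices of degree at least `3` uncovers nothing and lowers the
excess. -/
lemma IsOptimal.valence_eq_two_of_adj (hF : G.IsOptimal F b) {u v : V} (h : F.Adj u v)
    (hu : 3 ≤ F.valence u) : F.valence v = 2 := by
  by_contra hv
  have hv3 : 3 ≤ F.valence v := by
    have := h.symm.valence_pos
    have := hF.isDegGraph v
    omega
  have h1 := valence_sdiff_edge_left h
  have h2 := valence_sdiff_edge_right h
  have hval : ∀ w, (F \ edge u v).valence w ≤ F.valence w := valence_mono sdiff_le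
  have h3 : ∀ w, F.valence w = (F \ edge u v).valence w ∨
      3 ≤ F.valence w ∧ (F \ edge u v).valence w + 1 = F.valence w := by
    intro w
    by_cases hwu : w = u
    · subst hwu; exact Or.inr ⟨hu, h1⟩
    by_cases hwv : w = v
    · subst hwv; exact Or.inr ⟨hv3, h2⟩
    exact Or.inl (valence_sdiff_edge_of_ne hwu hwv).symm
  have hgood : (F \ edge u v).IsDegGraph b := by
    intro w
    have := hF.isDegGraph w
    have := h3 w
    omega
  have hZ : (F \ edge u v).isolatedSet ⊆ F.isolatedSet := by
    intro w hw
    rw [mem_isolatedSet] at hw ⊢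
    have := h3 w
    omega
  have := hF.excess_le _ (sdiff_le.trans hF.le) hgood (indepOn_mono hZ)
  have := excess_lt (fun w => Or.inl (hval w)) (v := u) (by omega) hu
  omega

/-- The ends of a longest path of uncovered vertices have at most one uncovered neighbour. -/
lemma IsOptimal.exists_path (hF : G.IsOptimal F b) (hb : 2 ≤ b) (hne : F.isolatedSet.Nonempty) :
    ∃ x₁ x₂, ∃ p : G.Walk x₁ x₂, p.IsPath ∧ (∀ x ∈ p.support, x ∈ F.isolatedSet) ∧
      (∀ w ∈ F.isolatedSet, G.Adj x₁ w → w ∈ p.support) ∧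
      (∀ w ∈ F.isolatedSet, G.Adj x₁ w → w = p.snd) ∧
      (∀ w ∈ F.isolatedSet, G.Adj x₂ w → w = p.reverse.snd) := by
  classical
  let L : Set ℕ := {n | ∃ x₁ x₂, ∃ p : G.Walk x₁ x₂, p.IsPath ∧
    (∀ x ∈ p.support, x ∈ F.isolatedSet) ∧ p.length = n}
  have hL : L.Nonempty := by
    obtain ⟨x, hx⟩ := hne
    exact ⟨0, x, x, Walk.nil, Walk.IsPath.nil, by simpa using hx, rfl⟩
  have hbdd : BddAbove L := by
    refine ⟨Fintype.card V, ?_⟩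
    rintro n ⟨x₁, x₂, p, hp, -, rfl⟩
    exact hp.length_lt.le
  have hmax : ∀ {x₁ x₂} (p : G.Walk x₁ x₂), p.IsPath → (∀ x ∈ p.support, x ∈ F.isolatedSet) →
      p.length ≤ sSup L := fun p hp hps => le_csSup hbdd ⟨_, _, p, hp, hps, rfl⟩
  have hend : ∀ {x₁ x₂} (p : G.Walk x₁ x₂), p.IsPath → (∀ x ∈ p.support, x ∈ F.isolatedSet) →
      p.length = sSup L → ∀ w ∈ F.isolatedSet, G.Adj x₁ w → w ∈ p.support := by
    intro x₁ x₂ p hp hps hlen w hw hadj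
    by_contra hwp
    have := hmax (Walk.cons hadj.symm p) (hp.cons hwp) (by
      intro x hx
      rw [Walk.support_cons, List.mem_cons] at hx
      rcases hx with rfl | hx
      · exact hw
      · exact hps x hx)
    rw [Walk.length_cons] at this
    omega
  have huniq : ∀ {x₁ x₂} (p : G.Walk x₁ x₂), p.IsPath → (∀ x ∈ p.support, x ∈ F.isolatedSet) →
      p.length = sSup L → ∀ w ∈ F.isolatedSet, G.Adj x₁ w → w = p.snd := by
    intro x₁ x₂ p hp hps hlen w hw hadj
    by_contra hws
    have hwp := hend p hp hps hlen w hw hadj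
    have hx₁ : F.valence x₁ = 0 := hps _ p.start_mem_support
    have hF1 : ¬F.Adj x₁ w := valence_eq_zero.1 hx₁ w
    -- The edge `x₁ w` and the path up to `w` form a cycle of uncovered vertices. Adding it creates
    -- only degrees `2`, so the excess is unchanged and fewer vertices stay uncovered.
    obtain ⟨F', hF'G, hHF', e1, e2, e3, e4⟩ := exists_add_path (H := F ⊔ edge x₁ w)
      (p.takeUntil w hwp) (hp.takeUntil hwp) hadj.ne
      (sup_le hF.le (by rw [edge_le_iff]; exact Or.inr hadj)) (by
        intro hl
        refine absurd ?_ hws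
        rw [← Walk.snd_takeUntil hadj.ne' p hwp, Walk.snd, ← hl, Walk.getVert_length]) (by
        intro x hx hx1 hx2
        rw [mem_isolatedSet, valence_sup_edge_of_ne hx1 hx2]
        exact hps x (p.support_takeUntil_subset_support hwp hx))
    rw [valence_sup_edge_left hF1 hadj.ne, hx₁] at e1
    rw [valence_sup_edge_right hF1 hadj.ne, mem_isolatedSet.1 hw] at e2
    have hval : ∀ v, F'.valence v = F.valence v ∨ F'.valence v = 2 := by
      intro v
      by_cases h1 : v = x₁
      · right; rw [h1, e1]
      by_cases h2 : v = w
      · right; rw [h2, e2]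
      by_cases hv : v ∈ (p.takeUntil w hwp).support
      · exact Or.inr (e3 v hv h1 h2)
      · left; rw [e4 v hv, valence_sup_edge_of_ne h1 h2]
    have hZ : F'.isolatedSet ⊂ F.isolatedSet := by
      refine ⟨isolatedSet_anti (le_sup_left.trans hHF'), fun h => ?_⟩
      have := h hx₁
      rw [mem_isolatedSet] at this
      omega
    have := hF.ncard_le F' hF'G (by
      intro v
      rcases hval v with h | h
      · rw [h]; exact hF.isDegGraph v
      · omega) (indepOn_mono hZ.subset) (SimpleGraph.excess_le fun v => by
        rcases hval v with h | h
        · exact Or.inl h.le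
        · exact Or.inr h.le)
    have := Set.ncard_lt_ncard hZ
    omega
  obtain ⟨x₁, x₂, p, hp, hps, hlen⟩ := Nat.sSup_mem hL hbdd
  have hps' : ∀ x ∈ p.reverse.support, x ∈ F.isolatedSet := by simpa using hps
  have hlen' : p.reverse.length = sSup L := by rw [Walk.length_reverse, hlen]
  refine ⟨x₁, x₂, p, hp, hps, hend p hp hps hlen, huniq p hp hps hlen,
    huniq _ hp.reverse hps' hlen'⟩

end Absorb

/-! ### Gains in an optimal graph. -/

section Optimal

variable {V : Type*} {G F H H' : SimpleGraph V} {b : ℕ} {y y' e e' x₁ x₂ t : V}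
  {k k' : F.threadGraph.ConnectedComponent}

lemma IsDegGraph.three_le (hF : F.IsDegGraph b) {v : V} (h0 : F.valence v ≠ 0)
    (h2 : F.valence v ≠ 2) : 3 ≤ F.valence v := by
  have := hF v; omega

lemma ErosionProfile.valence_cases (hF : F.IsDegGraph b)
    (hP : ErosionProfile F y k H e) (v : V) (hve : v ≠ e) (hvy : v ≠ y) :
    H.valence v = 0 ∨ 2 ≤ H.valence v ∧ H.valence v ≤ b := by
  have hb := hF v
  by_cases h2 : F.valence v = 2
  · have := hP.valence_two v hve h2
    omega
  · rwa [hP.valence_ne_two v hvy h2]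

lemma ErosionProfile.valence_eq_two_of_isolated (hP : ErosionProfile F y k H e)
    (hy : 3 ≤ F.valence y) {v : V} (hv : v ∈ H.isolatedSet) (hvF : v ∉ F.isolatedSet) :
    F.valence v = 2 := by
  by_contra h2
  by_cases hvy : v = y
  · subst hvy
    have := hP.valence_source
    rw [mem_isolatedSet] at hv
    omega
  · rw [mem_isolatedSet, hP.valence_ne_two v hvy h2] at hv
    exact hvF hv

/-- The ends of a path of uncovered vertices have a common neighbour `t` which could be
given one more edge, but not two, and which is the only such neighbour of `x₁`. -/
structure IsPivot (G F : SimpleGraph V) (b : ℕ) {x₁ x₂ : V} (p : G.Walk x₁ x₂) (t : V) : Prop where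
  isPath : p.IsPath
  ne : x₁ ≠ x₂
  support : ∀ x ∈ p.support, x ∈ F.isolatedSet
  nbr : ∀ w ∈ F.isolatedSet, G.Adj x₁ w → w ∈ p.support
  nbr_snd : ∀ w ∈ F.isolatedSet, G.Adj x₁ w → w = p.snd
  adj₁ : G.Adj x₁ t
  adj₂ : G.Adj x₂ t
  valence : F.valence t + 1 = b
  valence_eq : ∀ v ∉ F.isolatedSet, G.Adj x₁ v → v ≠ t → F.valence v = b

/-- Covered neighbours of `x₁` have degree at least `b - 1 ≥ 3`, so an eroded vertex, of degree `2`
in `F`, is never adjacent to `x₁`. -/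
lemma IsPivot.mem_isolatedSet {p : G.Walk x₁ x₂} (hp : IsPivot G F b p t) (hb : 4 ≤ b) {w : V}
    (hw : w ∉ F.isolatedSet → F.valence w = 2) (hadj : G.Adj x₁ w) : w ∈ F.isolatedSet := by
  by_contra hc
  have h2 := hw hc
  have hv := hp.valence
  have := hp.valence_eq w hc hadj (by rintro rfl; omega)
  omega

variable [Fintype V]

/-- Otherwise deleting the whole thread would lower the excess at no cost. A thread returning to `y`
takes two edges from it, hence the degree `4` required in that case. -/
lemma IsOptimal.lt_indepOn_insert (hF : G.IsOptimal F b) (hy : 3 ≤ F.valence y)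
    (hE : Erosion F y k H e) (h : H.Adj e e')
    (he' : F.valence e' ≠ 2) (hey : e' = y → 4 ≤ F.valence y) :
    G.indepOn F.isolatedSet < G.indepOn (insert e H.isolatedSet) := by
  by_contra hle
  have hP := hE.profile hy
  have he'3 : 3 ≤ F.valence e' :=
    hF.isDegGraph.three_le (hP.le h).symm.valence_pos.ne' he'
  have hHe' : 3 ≤ H.valence e' := by
    by_cases hc : e' = y
    · have := hey hc
      have := hP.valence_source
      subst hc; omega
    · rwa [hP.valence_ne_two e' hc he']
  have hlt := valence_sdiff_edge_right h
  have hm := valence_mono hP.le e'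
  have hZ := isolatedSet_sdiff_edge h hP.valence_end' (by omega)
  rw [← hZ] at hle
  have hgood : (H \ edge e e').IsDegGraph b := by
    intro v
    by_cases hve : v = e
    · left
      have := valence_sdiff_edge_left h
      rw [hve]
      have := hP.valence_end'
      omega
    have hbv := hF.isDegGraph v
    by_cases hve' : v = e'
    · subst hve'; omega
    rw [valence_sdiff_edge_of_ne hve hve']
    by_cases hvy : v = y
    · have := hP.valence_source
      subst hvy; omega
    · exact hP.valence_cases hF.isDegGraph v hve hvy
  have := hF.excess_le _ (sdiff_le.trans (hP.le.trans hF.le)) hgood (by omega)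
  have := excess_lt (F := F) (H := H \ edge e e')
    (fun w => Or.inl (valence_mono (sdiff_le.trans hP.le) w)) (v := e') (by omega) he'3
  omega

/-- Joining the loose ends restores degree `2` along the new path, while `y` and `y'` lose edges, so
the excess drops. If `y = y'`, two edges are lost there. -/
lemma IsOptimal.not_linked (hF : G.IsOptimal F b) (hb : 2 ≤ b) (hy : 3 ≤ F.valence y)
    (hy' : 3 ≤ F.valence y') (hyy : y = y' → 4 ≤ F.valence y) (hk : k ≠ k')
    (hE : Erosion F y k H e) (hE' : Erosion F y' k' H' e')
    (ha : G.indepOn (H.isolatedSet ∪ H'.isolatedSet) ≤ G.indepOn F.isolatedSet) :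
    ¬G.Linked F.isolatedSet e e' := by
  intro hl
  obtain ⟨F', hF'G, hZ, e1, e2, e3, e4, -⟩ :=
    (hE.profile hy).exists_join (hE'.profile hy') hy hy' hk hF.le hl
  have hcase : ∀ v, F'.valence v = 0 ∨ F'.valence v = 2 ∨
      (3 ≤ F.valence v ∧ 2 ≤ F'.valence v ∧ F'.valence v ≤ F.valence v) := by
    intro v
    by_cases h0 : F.valence v = 0
    · have := e1 v (Or.inl h0); omega
    by_cases h2 : F.valence v = 2
    · have := e1 v (Or.inr h2); omega
    have h3 := hF.isDegGraph.three_le h0 h2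
    right; right
    by_cases hyy' : y = y'
    · have h4 := e4 hyy'
      have h5 := hyy hyy'
      by_cases hvy : v = y
      · subst hvy; omega
      · rw [e2 v h0 h2 hvy (hyy' ▸ hvy)]; omega
    · have h4 := e3 hyy'
      by_cases hvy : v = y
      · subst hvy; omega
      by_cases hvy' : v = y'
      · subst hvy'; omega
      rw [e2 v h0 h2 hvy hvy']; omega
  have hylt : F'.valence y < F.valence y := by
    by_cases hyy' : y = y'
    · have := e4 hyy'; omega
    · have := e3 hyy'; omega
  have hgood : F'.IsDegGraph b := by
    intro v
    have := hcase v
    have := hF.isDegGraph v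
    omega
  have := hF.excess_le F' hF'G hgood ((indepOn_mono hZ).trans ha)
  have := excess_lt (F := F) (H := F') (fun v => by have := hcase v; omega) hylt hy
  omega

/-- Deleting a thread with both ends at `t` leaves `t` with degree `b - 3 ≥ 1`; attaching both ends
of `p` to `t` then restores degree `b - 1` and contradicts `IsOptimal.not_absorb`. -/
lemma IsOptimal.lt_indepOn_insert_of_isPivot (hF : G.IsOptimal F b) (hb : 4 ≤ b)
    {p : G.Walk x₁ x₂} (hp : IsPivot G F b p t) (hE : Erosion F t k H e) (h : H.Adj e t) :
    G.indepOn F.isolatedSet < G.indepOn (insert e H.isolatedSet) := by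
  by_contra hle
  have hv := hp.valence
  have ht : 3 ≤ F.valence t := by omega
  have hP := hE.profile ht
  have hs := hP.valence_source
  have hlt := valence_sdiff_edge_right h
  have hZ := isolatedSet_sdiff_edge h hP.valence_end' (by omega)
  rw [← hZ] at hle
  refine hF.not_absorb (t₁ := t) (t₂ := t) (H := H \ edge e t) (by omega)
    (sdiff_le.trans (hP.le.trans hF.le)) (by omega) p hp.isPath ?_ ?_ hp.adj₁.symm hp.adj₂ ?_
    (by omega) (by omega) (fun h => (h rfl).elim) (fun _ => ⟨hp.ne, by omega⟩)
  · intro x hx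
    rw [hZ]
    exact Or.inr (hP.isolatedSet_subset (hp.support x hx))
  · intro w hw hadj
    refine hp.nbr w (hp.mem_isolatedSet hb (fun hc => ?_) hadj) hadj
    rw [hZ] at hw
    rcases hw with rfl | hw
    · exact hP.valence_end
    · exact hP.valence_eq_two_of_isolated ht hw hc
  · intro v hvt _
    by_cases hve : v = e
    · subst hve
      have := valence_sdiff_edge_left h
      have := hP.valence_end'
      omega
    · rw [valence_sdiff_edge_of_ne hve hvt]
      exact hP.valence_cases hF.isDegGraph v hve hvt

/-- Otherwise the eroded segment is replaced by a path from `t` through `x₁` to `e`. It covers `x₁`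
and its only uncovered neighbour, so the independence number of the rest drops. -/
lemma IsOptimal.not_linked_start_of_isPivot (hF : G.IsOptimal F b) (hb : 4 ≤ b)
    {p : G.Walk x₁ x₂} (hp : IsPivot G F b p t) (hE : Erosion F t k H e)
    (ha : G.indepOn H.isolatedSet ≤ G.indepOn F.isolatedSet) :
    ¬G.Linked F.isolatedSet x₁ e := by
  intro hl
  have hv := hp.valence
  have ht : 3 ≤ F.valence t := by omega
  have hP := hE.profile ht
  have hx₁ : x₁ ∈ F.isolatedSet := hp.support _ p.start_mem_support
  have hx₁0 : F.valence x₁ = 0 := hx₁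
  have he2 := hP.valence_end
  have hx₁e : x₁ ≠ e := by rintro rfl; omega
  have ht0 : t ∉ F.isolatedSet := by rw [SimpleGraph.mem_isolatedSet]; omega
  have hte : t ≠ e := by rintro rfl; omega
  obtain ⟨q, hq, hqs⟩ := hl.exists_isPath
  have hqs' : ∀ x ∈ q.support, x ≠ e → x ∈ F.isolatedSet := by
    intro x hx hxe
    rcases hqs x hx with rfl | h | h
    · exact hx₁
    · exact absurd h hxe
    · exact h
  have htq : t ∉ q.support := fun h => ht0 (hqs' t h hte)
  have hlen : q.length ≠ 0 := fun h => hx₁e (Walk.eq_of_length_eq_zero h)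
  obtain ⟨F', hF'G, hHF', e1, e2, e3, e4⟩ := exists_add_path (H := H)
    (Walk.cons hp.adj₁.symm q) (hq.cons htq) hte (hP.le.trans hF.le)
    (fun h => absurd h (by rw [Walk.length_cons]; omega)) (by
      intro x hx hxt hxe
      rw [Walk.support_cons, List.mem_cons] at hx
      exact hP.isolatedSet_subset (hqs' x (hx.resolve_left hxt) hxe))
  have hs := hP.valence_source
  have he1 := hP.valence_end'
  have hqF' : ∀ x ∈ q.support, F'.valence x = 2 := by
    intro x hx
    by_cases hxe : x = e
    · rw [hxe]; omega
    · exact e3 x (List.mem_cons_of_mem _ hx) (by rintro rfl; exact htq hx) hxe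
  have hgood : F'.IsDegGraph b := by
    intro v
    by_cases hvq : v ∈ q.support
    · rw [hqF' v hvq]; omega
    by_cases hvt : v = t
    · subst hvt; omega
    rw [e4 v (by rw [Walk.support_cons, List.mem_cons, not_or]; exact ⟨hvt, hvq⟩)]
    exact hP.valence_cases hF.isDegGraph v (by rintro rfl; exact hvq q.end_mem_support) hvt
  -- The second vertex of `q` is an uncovered neighbour of `x₁`, and there is only one.
  have hsnd : p.snd ∈ q.support := by
    have hnil : ¬q.Nil := by rwa [← Walk.length_eq_zero_iff]
    have hadj : G.Adj x₁ q.snd := q.adj_snd hnil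
    have hmem : q.snd ∈ q.support := q.getVert_mem_support 1
    have hW : q.snd ∈ F.isolatedSet := hp.mem_isolatedSet hb (fun hc => by
      by_cases h : q.snd = e
      · rw [h, he2]
      · exact absurd (hqs' _ hmem h) hc) hadj
    rwa [← hp.nbr_snd _ hW hadj]
  have hlt : G.indepOn F'.isolatedSet < G.indepOn H.isolatedSet := by
    refine indepOn_lt (isolatedSet_anti hHF') (hP.isolatedSet_subset hx₁) (x := x₁) ?_ ?_
    · rw [SimpleGraph.mem_isolatedSet, hqF' _ q.start_mem_support]; omega
    · intro w hw hadj
      have hwF : w ∈ F.isolatedSet := hp.mem_isolatedSet hb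
        (fun hc => hP.valence_eq_two_of_isolated ht (isolatedSet_anti hHF' hw) hc) hadj
      rw [SimpleGraph.mem_isolatedSet, hqF' w (by rwa [hp.nbr_snd w hwF hadj])] at hw
      omega
  have := hF.indepOn_le F' hF'G hgood
  omega

/-- Joining the loose ends leaves `t` with degree `b - 3`, and then `p` can be absorbed with both
ends at `t`. -/
lemma IsOptimal.not_linked_of_isPivot (hF : G.IsOptimal F b) (hb : 4 ≤ b)
    {p : G.Walk x₁ x₂} (hp : IsPivot G F b p t) (hk : k ≠ k') (hE : Erosion F t k H e)
    (hE' : Erosion F t k' H' e')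
    (ha : G.indepOn (H.isolatedSet ∪ H'.isolatedSet) ≤ G.indepOn F.isolatedSet) :
    ¬G.Linked F.isolatedSet e e' := by
  classical
  intro hl
  have hv := hp.valence
  have ht : 3 ≤ F.valence t := by omega
  have hP := hE.profile ht
  have hP' := hE'.profile ht
  obtain ⟨F', hF'G, hZ, e1, e2, -, e4, e5⟩ := hP.exists_join hP' ht ht hk hF.le hl
  have ht' := e4 rfl
  have hstart := hF.not_linked_start_of_isPivot hb hp hE
    ((indepOn_mono Set.subset_union_left).trans ha)
  refine hF.not_absorb (t₁ := t) (t₂ := t) (H := F') (by omega) hF'G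
    ((indepOn_mono hZ).trans ha) p hp.isPath ?_ ?_ hp.adj₁.symm hp.adj₂ ?_
    (by omega) (by omega) (fun h => (h rfl).elim) (fun _ => ⟨hp.ne, by omega⟩)
  · intro x hx
    -- The joining path misses `p`: a common vertex would link `e` to `x₁` along `p`, against
    -- `hstart`.
    by_contra hc
    have hxF := hp.support x hx
    refine hstart (Linked.symm ((e5 x hxF hc).trans
      ⟨(p.takeUntil x hx).reverse, fun w hw => ?_⟩ (Or.inr (Or.inr hxF))))
    rw [Walk.support_reverse, List.mem_reverse] at hw
    exact Or.inr (Or.inr (hp.support w (p.support_takeUntil_subset_support hx hw)))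
  · intro w hw hadj
    refine hp.nbr w (hp.mem_isolatedSet hb (fun hc => ?_) hadj) hadj
    rcases hZ hw with hw | hw
    · exact hP.valence_eq_two_of_isolated ht hw hc
    · exact hP'.valence_eq_two_of_isolated ht hw hc
  · intro v hvt _
    have hbv := hF.isDegGraph v
    by_cases h0 : F.valence v = 0
    · have := e1 v (Or.inl h0); omega
    by_cases h2 : F.valence v = 2
    · have := e1 v (Or.inr h2); omega
    rw [e2 v h0 h2 hvt hvt]
    exact hbv

lemma IsOptimal.exists_gain_of_forall_eq (hF : G.IsOptimal F b) (hb : 4 ≤ b) (Y : Finset V)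
    (hY : ∀ y ∈ Y, F.valence y = b) {d : ℕ} (hd : d ≤ Y.card) :
    ∃ m, G.indepOn F.isolatedSet + m ≤ G.indepNum ∧ b * d ≤ 2 * m + 1 := by
  have hY3 : ∀ y ∈ Y, 3 ≤ F.valence y := fun y hy => by rw [hY y hy]; omega
  have hY2 : ∀ y ∈ Y, ∀ z, F.Adj y z → F.valence z = 2 :=
    fun y hy z hz => hF.valence_eq_two_of_adj hz (hY3 y hy)
  refine ⟨(F.threadsAt Y).card, indepOn_add_card_threadsAt_le Y hY3 hY2 ?_ ?_, ?_⟩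
  · intro y hy k H e e' hE _ h he'
    exact hF.lt_indepOn_insert (hY3 y hy) hE h he' fun _ => by rw [hY y hy]; omega
  · intro y hy y' hy' k k' hk H e H' e' hE hE' ha
    exact hF.not_linked (by omega) (hY3 y hy) (hY3 y' hy') (fun _ => by rw [hY y hy]; omega) hk hE
      hE' ha
  · have h1 := sum_valence_le_two_mul_card_threadsAt Y hY3 hY2
    rw [Finset.sum_congr rfl hY, Finset.sum_const, smul_eq_mul, mul_comm] at h1
    have := Nat.mul_le_mul_left b hd
    omega

/-- The pivot costs at most `1` in the degree sum over `Y`, which accounts for the summand `1` in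
the bound. The pivot lemmas are needed only where `t` would lose two edges. -/
lemma IsOptimal.exists_gain_of_isPivot (hF : G.IsOptimal F b) (hb : 4 ≤ b)
    {p : G.Walk x₁ x₂} (hp : IsPivot G F b p t) (Y : Finset V)
    (hY : ∀ y ∈ Y, y ≠ t → F.valence y = b) {d : ℕ} (hd : d ≤ Y.card) :
    ∃ m, G.indepOn F.isolatedSet + m ≤ G.indepNum ∧ b * d ≤ 2 * m + 1 := by
  classical
  have hv := hp.valence
  have hYc : ∀ y ∈ Y, F.valence y + (if y = t then 1 else 0) = b := by
    intro y hy
    split_ifs with h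
    · rw [h, hv]
    · exact hY y hy h
  have hY3 : ∀ y ∈ Y, 3 ≤ F.valence y := fun y hy => by
    have := hYc y hy
    split_ifs at this <;> omega
  have hY2 : ∀ y ∈ Y, ∀ z, F.Adj y z → F.valence z = 2 :=
    fun y hy z hz => hF.valence_eq_two_of_adj hz (hY3 y hy)
  refine ⟨(F.threadsAt Y).card, indepOn_add_card_threadsAt_le Y hY3 hY2 ?_ ?_, ?_⟩
  · intro y hy k H e e' hE _ h he'
    by_cases hyt : e' = y ∧ y = t
    · obtain ⟨rfl, rfl⟩ := hyt
      exact hF.lt_indepOn_insert_of_isPivot hb hp hE h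
    · exact hF.lt_indepOn_insert (hY3 y hy) hE h he' fun hey => by
        rw [hY y hy fun hyt' => hyt ⟨hey, hyt'⟩]; omega
  · intro y hy y' hy' k k' hk H e H' e' hE hE' ha
    by_cases hyt : y = y' ∧ y = t
    · obtain ⟨rfl, rfl⟩ := hyt
      exact hF.not_linked_of_isPivot hb hp hk hE hE' ha
    · exact hF.not_linked (by omega) (hY3 y hy) (hY3 y' hy') (fun hyy => by
        rw [hY y hy fun hyt' => hyt ⟨hyy, hyt'⟩]; omega) hk hE hE' ha
  · have h1 := sum_valence_le_two_mul_card_threadsAt Y hY3 hY2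
    have h2 := Finset.sum_congr rfl hYc
    rw [Finset.sum_add_distrib, Finset.sum_const, smul_eq_mul, mul_comm, Finset.sum_ite_eq'] at h2
    have h3 := Nat.mul_le_mul_left b hd
    split_ifs at h2 <;> omega

lemma IsOptimal.exists_gain (hF : G.IsOptimal F b) (hb : 4 ≤ b) {d : ℕ}
    (hd : ∀ v, d + 1 ≤ G.valence v) (hne : F.isolatedSet.Nonempty) :
    ∃ m, G.indepOn F.isolatedSet + m ≤ G.indepNum ∧ b * d ≤ 2 * m + 1 := by
  classical
  obtain ⟨x₁, x₂, p, hp, hps, hn₁, hu₁, hu₂⟩ := hF.exists_path (by omega) hne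
  let N : V → Finset V := fun x => Finset.univ.filter fun y => G.Adj x y ∧ y ∉ F.isolatedSet
  have hN : ∀ x y, y ∈ N x ↔ G.Adj x y ∧ y ∉ F.isolatedSet := by simp [N]
  have hNcard : ∀ x w, (∀ u ∈ F.isolatedSet, G.Adj x u → u = w) → d ≤ (N x).card := by
    intro x w hw
    have h1 : G.neighborSet x ⊆ (insert w (N x) : Finset V) := by
      intro u hu
      rw [Finset.coe_insert]
      by_cases hc : u ∈ F.isolatedSet
      · exact Or.inl (hw u hc hu)
      · exact Or.inr (Finset.mem_coe.2 ((hN x u).2 ⟨hu, hc⟩))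
    have h2 := Set.ncard_le_ncard h1
    rw [Set.ncard_coe_finset] at h2
    have := Finset.card_insert_le w (N x)
    have := hd x
    rw [valence] at this
    omega
  have hle : ∀ v, F.valence v ≤ b := fun v => by have := hF.isDegGraph v; omega
  -- Two attachment points with spare degree would allow absorption, unless they coincide and either
  -- the path is a single vertex or the common point has only one place left.
  have habs : ∀ t₁ ∈ N x₁, ∀ t₂ ∈ N x₂, F.valence t₁ ≠ b → F.valence t₂ ≠ b →
      t₁ = t₂ ∧ (x₁ = x₂ ∨ F.valence t₁ + 1 = b) := by
    intro t₁ ht₁ t₂ ht₂ hb₁ hb₂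
    rw [hN] at ht₁ ht₂
    have h1 := hle t₁
    have h2 := hle t₂
    by_contra hc
    refine hF.not_absorb (t₁ := t₁) (t₂ := t₂) (by omega) hF.le le_rfl p hp hps hn₁ ht₁.1.symm
      ht₂.1 (fun v _ _ => hF.isDegGraph v) (Nat.pos_of_ne_zero ht₁.2) (Nat.pos_of_ne_zero ht₂.2)
      (fun _ => by omega) fun ht => ?_
    rw [not_and_or, not_or] at hc
    have := hc.resolve_left (not_not.2 ht)
    exact ⟨this.1, by omega⟩
  rcases eq_or_ne x₁ x₂ with rfl | hx
  · have hnil : p = Walk.nil := (Walk.isPath_iff_nil.1 hp).eq_nil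
    have hlow : ((N x₁).filter fun y => ¬F.valence y = b).card ≤ 1 := by
      rw [Finset.card_le_one]
      intro t₁ ht₁ t₂ ht₂
      rw [Finset.mem_filter] at ht₁ ht₂
      exact (habs t₁ ht₁.1 t₂ ht₂.1 ht₁.2 ht₂.2).1
    -- A one-vertex longest path has no uncovered neighbour, so all `d + 1` neighbours are covered;
    -- this makes up for the one that may have degree below `b`.
    have hcard : d + 1 ≤ (N x₁).card := by
      have h1 : G.neighborSet x₁ ⊆ (N x₁ : Set V) := by
        intro u hu
        refine Finset.mem_coe.2 ((hN x₁ u).2 ⟨hu, fun hc => ?_⟩)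
        have := hn₁ u hc hu
        rw [hnil, Walk.support_nil, List.mem_singleton] at this
        exact G.loopless.irrefl _ (this ▸ hu : G.Adj x₁ x₁)
      have h2 := Set.ncard_le_ncard h1
      rw [Set.ncard_coe_finset] at h2
      exact (hd x₁).trans h2
    have := Finset.card_filter_add_card_filter_not (s := N x₁) (fun y => F.valence y = b)
    exact hF.exists_gain_of_forall_eq hb ((N x₁).filter fun y => F.valence y = b)
      (fun y hy => (Finset.mem_filter.1 hy).2) (by omega)
  · by_cases h₁ : ∀ t ∈ N x₁, F.valence t = b
    · exact hF.exists_gain_of_forall_eq hb (N x₁) h₁ (hNcard x₁ _ hu₁)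
    by_cases h₂ : ∀ t ∈ N x₂, F.valence t = b
    · exact hF.exists_gain_of_forall_eq hb (N x₂) h₂ (hNcard x₂ _ hu₂)
    push Not at h₁ h₂
    obtain ⟨t₁, ht₁, hb₁⟩ := h₁
    obtain ⟨t, ht, hbt⟩ := h₂
    obtain ⟨rfl, hval⟩ := habs t₁ ht₁ t ht hb₁ hbt
    have heq : ∀ v ∈ N x₁, v ≠ t₁ → F.valence v = b := by
      intro v hv hvt
      by_contra hc
      exact hvt (habs v hv t₁ ht hc hbt).1
    exact hF.exists_gain_of_isPivot hb (p := p) (t := t₁)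
      ⟨hp, hx, hps, hn₁, hu₁, ((hN _ _).1 ht₁).1, ((hN _ _).1 ht).1, hval.resolve_left hx,
        fun v hv hadj hvt => heq v ((hN _ _).2 ⟨hadj, hv⟩) hvt⟩ (N x₁) heq (hNcard x₁ _ hu₁)

end Optimal

/-! ### Translation to subgraphs and pseudo factors. -/

section Subgraph

variable {V : Type*} {G : SimpleGraph V} {b : ℕ}

/-- The subgraph of `G` formed by the edges of `F` and their ends. -/
def supportSubgraph {F : SimpleGraph V} (hF : F ≤ G) : G.Subgraph where
  verts := F.support
  Adj := F.Adj
  adj_sub h := hF h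
  edge_vert h := ⟨_, h⟩
  symm := F.symm

lemma IsDegGraph.isDegSubgraph [Finite V] {F : SimpleGraph V} (hF : F ≤ G)
    (hd : F.IsDegGraph b) : (supportSubgraph hF).IsDegSubgraph 2 b := by
  rintro v ⟨w, hw⟩
  exact (hd v).resolve_left hw.valence_pos.ne'

lemma outside_supportSubgraph_indepNum [Finite V] {F : SimpleGraph V} (hF : F ≤ G) :
    (supportSubgraph hF).outside.indepNum = G.indepOn F.isolatedSet := by
  have : (supportSubgraph hF).vertsᶜ = F.isolatedSet := by
    ext v
    rw [mem_isolatedSet, valence_eq_zero, Set.mem_compl_iff]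
    exact not_exists
  rw [← this]
  rfl

lemma Subgraph.exists_isExtremal (G : SimpleGraph V) (b : ℕ) :
    ∃ F : G.Subgraph, F.IsExtremal b := by
  let key : G.Subgraph → ℕ ×ₗ ℕ ×ₗ ℕ := fun F =>
    toLex (F.outside.indepNum, toLex (F.outside.minComponentCard, F.verts.ncard))
  obtain ⟨F, hF, hmin⟩ := (InvImage.wf key wellFounded_lt).has_min
    {F | F.IsDegSubgraph 2 b} ⟨⊥, fun v hv => hv.elim⟩
  have hkey : ∀ F' : G.Subgraph, F'.IsDegSubgraph 2 b → ¬key F' < key F := fun F' h => hmin F' h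
  simp only [key, Prod.Lex.toLex_lt_toLex] at hkey
  refine ⟨F, hF, fun F' h1 => ?_, fun F' h1 h2 => ?_, fun F' h1 h2 h3 => ?_⟩ <;>
  · have := hkey F' h1
    omega

/-- The spanning subgraph of `G` with the same edges as `F`. -/
def Subgraph.toSpanning (F : G.Subgraph) : G.Subgraph where
  verts := Set.univ
  Adj := F.Adj
  adj_sub h := F.adj_sub h
  edge_vert _ := Set.mem_univ _
  symm := F.symm

lemma Subgraph.ncard_neighborSet_toSpanning (F : G.Subgraph) (v : F.toSpanning.verts) :
    (F.toSpanning.coe.neighborSet v).ncard = (F.neighborSet v).ncard := by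
  rw [← Set.ncard_image_of_injective _ Subtype.val_injective]
  congr 1
  ext w
  constructor
  · rintro ⟨u, hu, rfl⟩; exact hu
  · exact fun h => ⟨⟨w, Set.mem_univ w⟩, h, rfl⟩

variable [Finite V]

/-- A vertex of `F` has two neighbours in its component; any other vertex is isolated in
`F.toSpanning`. -/
lemma Subgraph.IsDegSubgraph.three_le_ncard_supp_iff {F : G.Subgraph} (hF : F.IsDegSubgraph 2 b)
    (v : F.toSpanning.verts) :
    3 ≤ (F.toSpanning.coe.connectedComponentMk v).supp.ncard ↔ (v : V) ∈ F.verts := by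
  constructor
  · intro h
    by_contra hv
    have hsub : (F.toSpanning.coe.connectedComponentMk v).supp ⊆ {v} := by
      intro w hw
      obtain ⟨p⟩ := (ConnectedComponent.exact hw).symm
      cases p with
      | nil => rfl
      | cons h _ => exact (hv (F.edge_vert h)).elim
    have := Set.ncard_le_ncard hsub
    rw [Set.ncard_singleton] at this
    omega
  · intro hv
    have hsub : insert v (F.toSpanning.coe.neighborSet v) ⊆
        (F.toSpanning.coe.connectedComponentMk v).supp := by
      rintro w (rfl | hw)
      · rfl
      · exact ConnectedComponent.sound (Adj.reachable hw).symm
    have h1 := Set.ncard_le_ncard hsub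
    rw [Set.ncard_insert_of_notMem (by simp), F.ncard_neighborSet_toSpanning] at h1
    have := (hF v hv).1
    omega

lemma Subgraph.IsDegSubgraph.isPseudoFactor {F : G.Subgraph} (hF : F.IsDegSubgraph 2 b) :
    F.toSpanning.IsPseudoFactor 2 b := by
  refine ⟨fun _ => Set.mem_univ _, fun C hC v hv => ?_⟩
  rw [ConnectedComponent.mem_supp_iff] at hv
  rw [F.ncard_neighborSet_toSpanning]
  exact hF v ((hF.three_le_ncard_supp_iff v).1 (hv ▸ hC))

lemma Subgraph.IsDegSubgraph.largePart_toSpanning {F : G.Subgraph} (hF : F.IsDegSubgraph 2 b) :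
    F.toSpanning.largePart = F := by
  have hverts : F.toSpanning.largePart.verts = F.verts := by
    ext v
    exact ⟨fun ⟨hv, h⟩ => (hF.three_le_ncard_supp_iff ⟨v, hv⟩).1 h,
      fun h => ⟨Set.mem_univ v, (hF.three_le_ncard_supp_iff ⟨v, Set.mem_univ v⟩).2 h⟩⟩
  refine Subgraph.ext hverts ?_
  ext u v
  constructor
  · exact fun h => h.2.2
  · intro h
    refine ⟨?_, ?_, h⟩
    · exact hverts.ge (F.edge_vert h)
    · exact hverts.ge (F.edge_vert h.symm)

end Subgraph

lemma exists_indepOn_isolatedSet_le {V : Type*} [Fintype V] (G : SimpleGraph V)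
    [DecidableRel G.Adj] (b : ℕ) (hb : 4 ≤ b) (hδ : 2 ≤ G.minDegree)
    (hα : (b : ℚ) * ((G.minDegree : ℚ) - 1) / 2 < (G.indepNum : ℚ)) :
    ∃ F ≤ G, F.IsDegGraph b ∧ (G.indepOn F.isolatedSet : ℤ) ≤
      (G.indepNum : ℤ) - ⌊(b : ℚ) / 2 * ((G.minDegree : ℚ) - 1)⌋ := by
  obtain ⟨F, hF⟩ := G.exists_isOptimal b
  refine ⟨F, hF.le, hF.isDegGraph, ?_⟩
  rcases F.isolatedSet.eq_empty_or_nonempty with h0 | hne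
  · rw [h0, indepOn_empty, Nat.cast_zero, sub_nonneg, ← Int.cast_le (R := ℚ)]
    refine (Int.floor_le _).trans ?_
    rw [Int.cast_natCast, div_mul_eq_mul_div]
    exact hα.le
  · obtain ⟨d, hd⟩ : ∃ d, G.minDegree = d + 1 := ⟨G.minDegree - 1, by omega⟩
    obtain ⟨m, hm, hbm⟩ := hF.exists_gain hb (d := d) (fun v => by
      rw [← hd, valence, ← Nat.card_coe_set_eq, Nat.card_eq_fintype_card,
        card_neighborSet_eq_degree]
      exact G.minDegree_le_degree v) hne
    -- From `b * d ≤ 2 * m + 1`, half of `b * d` is below `m + 1`: the floor absorbs the loss at the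
    -- pivot.
    have hfl : ⌊(b : ℚ) / 2 * ((G.minDegree : ℚ) - 1)⌋ ≤ (m : ℤ) := by
      rw [← Int.lt_add_one_iff, Int.floor_lt, hd]
      have : (b : ℚ) * d ≤ 2 * m + 1 := by exact_mod_cast hbm
      push_cast
      linarith
    omega

end SimpleGraph

theorem theorem2 {V : Type*} [Fintype V] (G : SimpleGraph V) [DecidableRel G.Adj] (b : ℕ)
    (hb : 4 ≤ b) (hδ : 2 ≤ G.minDegree)
    (hα : (b : ℚ) * ((G.minDegree : ℚ) - 1) / 2 < (G.indepNum : ℚ)) :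
    (∃ F : G.Subgraph, F.IsExtremal b) ∧
      ∀ F : G.Subgraph, F.IsExtremal b →
        (∃ H : G.Subgraph, H.IsPseudoFactor 2 b ∧ H.largePart = F) ∧
          (F.outside.indepNum : ℤ) ≤
            (G.indepNum : ℤ) - ⌊(b : ℚ) / 2 * ((G.minDegree : ℚ) - 1)⌋ := by
  refine ⟨SimpleGraph.Subgraph.exists_isExtremal G b, fun F hF => ⟨⟨F.toSpanning,
    hF.isDegSubgraph.isPseudoFactor, hF.isDegSubgraph.largePart_toSpanning⟩, ?_⟩⟩
  obtain ⟨F', hF', hd, hle⟩ := G.exists_indepOn_isolatedSet_le b hb hδ hα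
  have := hF.indepNum_le _ (hd.isDegSubgraph hF')
  rw [SimpleGraph.outside_supportSubgraph_indepNum] at this
  omega
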